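/- Setting. Consider cellular automata on $\mathbb Z$ with states $\{0,1,2\}$ and range $2$: $\xi_{t+1}(x)=f(\xi_t(x-2),\xi_t(x-1),\xi_t(x),\xi_t(x+1),\xi_t(x+2))$. Write $\delta(a)=\mathbf 1[a=1]$. The rule $f$ is a web rule if $f(0,0,0,0,0)=0$ and $\delta(f(a,b,c,d,e))\equiv\delta(b)+\delta(c)+\delta(d)\pmod 2$ for all $a,\dots,e$. In the following, $a,\dots,e,a',\dots,e'$ range over all states with $\delta(a)=\delta(a'),\dots,\delta(e)=\delta(e')$. The rule is diagonal-compliant if $f(a,b,c,d,e)=f(a',b,c',d,e')$ always. It is wide-compliant if $f(a,b,c,d,e)=f(a',b,c,d,e')$ always, and moreover $f(a,b,c,d,e)=f(a',b,c,d',e')$ whenever $c=1$ and $\delta(c)+\delta(d)+\delta(e)$ is odd, and $f(a,b,c,d,e)=f(a',b',c,d,e')$ whenever $c=1$ and $\delta(a)+\delta(b)+\delta(c)$ is odd. The rule has no spontaneous birth if whenever $\xi_0$ contains no $2$s, $\xi_1$ contains no $2$s; otherwise it has spontaneous birth. An ether is an element $\eta\in\{0,2\}^{\mathbb Z^2}$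 that is periodic in both coordinates; two ethers are equivalent if they differ by a translation of $\mathbb Z^2$. Let $\Lambda\subset\mathbb Z\times[0,\infty)$ be the set of space-time points in state $1$ in the evolution of $\lambda_{t+1}(x)=\lambda_t(x-1)+\lambda_t(x)+\lambda_t(x+1) \bmod 2$ started from a single $1$ at the origin, and let $\Lambda(r)\subset\mathbb Z^2$ be the set of points at $\ell^1$-distance at most $r$ from $\Lambda$. A space-time configuration $\xi$ is a replicator of thickness $r$ and ether $\eta$ if on each bounded (nearest-neighbour) connected component of $\mathbb Z^2\setminus\Lambda(r)$ it agrees with some ether equivalent to $\eta$. A binary seed on $[0,L]$ is an initial configuration with values in $\{0,1\}$ on $[0,L]$ and $0$ elsewhere; a uniformly random one has independent values on $[0,L]$, equal to $0$ or $1$ with probability $1/2$ each. Theorem. Let $f$ be a web rule that is diagonal-compliant or wide-compliant. For each $L\ge 0$ one can choose $R_L\in[0,\infty]$ and an ether $\eta_L$, both deterministic functions of the binary seed on $[0,L]$, such that all of the following hold. (a) For uniformly random binary seeds on $[0,L]$, $\mathbb P(R_L=\infty)\to0$ as $L\to\infty$, and $(R_L)$ is tight as $L\to\infty$: for every $\varepsilon>0$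 there is $K<\infty$ with $\mathbb P(R_L>K)\le\varepsilon$ for all sufficiently large $L$. (b) Whenever $R_L<\infty$, the configuration $\xi$ started from the seed is a replicator of thickness $R_L+L$ and ether $\eta_L$; and the same holds, with the same $R_L$ and $\eta_L$, for the evolution started after changing any finite set of $0$s of the seed (anywhere in $\mathbb Z$) into $2$s. (i) If the rule has no spontaneous birth, then $\eta_L\equiv0$ whenever $R_L<\infty$. (ii) Suppose that the rule has spontaneous birth. If for some deterministic ether $\eta$ we have $R_{L_0}<\infty$ and $\eta_{L_0}=\eta$ for some $L_0\ge0$ and some binary seed on $[0,L_0]$, then for uniformly random binary seeds on $[0,L]$, $$\liminf_{L\to\infty}\mathbb P(R_L<\infty\text{ and }\eta_L=\eta)>0.$$ -/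

import Mathlib

open Filter MeasureTheory Topology
open scoped ENNReal NNReal

/-- A local rule of a range-`2` cellular automaton on `ℤ` with states `0, 1, 2`. -/
abbrev CARule : Type := Fin 3 → Fin 3 → Fin 3 → Fin 3 → Fin 3 → Fin 3

namespace CARule

/-- One step of the cellular automaton with rule `f`. -/
def step (f : CARule) (ξ : ℤ → Fin 3) : ℤ → Fin 3 :=
  fun x => f (ξ (x - 2)) (ξ (x - 1)) (ξ x) (ξ (x + 1)) (ξ (x + 2))

/-- The configuration `ξ_t` at time `t` started from `ξ₀`. -/
def evolve (f : CARule) (ξ₀ : ℤ → Fin 3) : ℕ → ℤ → Fin 3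
  | 0 => ξ₀
  | t + 1 => f.step (evolve f ξ₀ t)

/-- `δ(a) = 1[a = 1]`, as an element of the integers modulo `2`. -/
def delta (a : Fin 3) : ZMod 2 := if a = 1 then 1 else 0

/-- Web rules: the `1`s evolve according to the *1 Or 3* rule, and `0` is quiescent. -/
structure IsWeb (f : CARule) : Prop where
  first_level : ∀ a b c d e, delta (f a b c d e) = delta b + delta c + delta d
  quiescent : f 0 0 0 0 0 = 0

/-- The new state depends on the non-adjacent cells only through their first level. -/
def EmptyCompliant (f : CARule) : Prop :=
  ∀ a b c d e a' e', delta a = delta a' → delta e = delta e' →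
    f a b c d e = f a' b c d e'

/-- The new state depends on all cells other than the two adjacent ones only through their
first level. -/
def DiagonalCompliant (f : CARule) : Prop :=
  ∀ a b c d e a' c' e', delta a = delta a' → delta c = delta c' → delta e = delta e' →
    f a b c d e = f a' b c' d e'

/-- Wide-compliance; `δ(c) + δ(d) + δ(e)` and `δ(a) + δ(b) + δ(c)` are the new first-level states
of the right and of the left neighbour. -/
structure WideCompliant (f : CARule) : Prop where
  empty : f.EmptyCompliant
  right : ∀ a b c d e a' d' e', delta a = delta a' → delta d = delta d' → delta e = delta e' →
    c = 1 → delta c + delta d + delta e = 1 → f a b c d e = f a' b c d' e'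
  left : ∀ a b c d e a' b' e', delta a = delta a' → delta b = delta b' → delta e = delta e' →
    c = 1 → delta a + delta b + delta c = 1 → f a b c d e = f a' b' c d e'

/-- If a configuration contains no `2`s, then neither does the next one. -/
def NoSpontaneousBirth (f : CARule) : Prop :=
  ∀ ξ : ℤ → Fin 3, (∀ x, ξ x ≠ 2) → ∀ x, f.step ξ x ≠ 2

end CARule

/-- The *1 Or 3* cellular automaton started from a single `1` at the origin. -/
def oneOrThreeSingle : ℕ → ℤ → ZMod 2
  | 0 => fun x => if x = 0 then 1 else 0
  | t + 1 => fun x =>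
      oneOrThreeSingle t (x - 1) + oneOrThreeSingle t x + oneOrThreeSingle t (x + 1)

/-- The support `Λ` of `oneOrThreeSingle`, a set of space-time points `(x, t)`. -/
def webSupport : Set (ℤ × ℤ) :=
  {p | ∃ t : ℕ, p.2 = t ∧ oneOrThreeSingle t p.1 = 1}

/-- The `ℓ¹` distance on `ℤ²`. -/
def l1Dist (p q : ℤ × ℤ) : ℤ := |p.1 - q.1| + |p.2 - q.2|

/-- `Λ(r)`: the points of `ℤ²` at `ℓ¹` distance at most `r` from `Λ`. -/
def thickWeb (r : ℝ) : Set (ℤ × ℤ) :=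
  {p | ∃ q ∈ webSupport, (l1Dist p q : ℝ) ≤ r}

/-- `K` is a (nearest-neighbour) connected component of the set `S ⊆ ℤ²`. -/
def IsLatticeComponent (S K : Set (ℤ × ℤ)) : Prop :=
  ∃ p ∈ S, K = {q | Relation.ReflTransGen (fun u v => l1Dist u v = 1 ∧ v ∈ S) p q}

/-- Ethers: elements of `{0,2}^{ℤ²}` that are periodic in both coordinates. -/
@[ext]
structure Ether where
  /-- the state at the space-time point `(x, t)` -/
  val : ℤ → ℤ → Fin 3
  ne_one : ∀ x t, val x t ≠ 1
  periodic_space : ∃ p : ℤ, 0 < p ∧ ∀ x t, val (x + p) t = val x t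
  periodic_time : ∃ q : ℤ, 0 < q ∧ ∀ x t, val x (t + q) = val x t

/-- Two ethers are equivalent if they differ by a translation of `ℤ²`. -/
def Ether.Equivalent (η η' : Ether) : Prop :=
  ∃ u v : ℤ, ∀ x t, η'.val x t = η.val (x + u) (t + v)

/-- The space-time configuration `ξ` (indexed by time and space) agrees on `K` with some ether
equivalent to `η`. -/
def FilledWith (ξ : ℕ → ℤ → Fin 3) (K : Set (ℤ × ℤ)) (η : Ether) : Prop :=
  ∃ η' : Ether, η.Equivalent η' ∧ ∀ (x : ℤ) (t : ℕ), (x, (t : ℤ)) ∈ K → ξ t x = η'.val x t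

/-- `ξ` is a replicator of thickness `r` and ether `η`: each bounded component of `ℤ² ∖ Λ(r)` is
filled with `η`.  (For `r ≥ 0` such a component lies in `ℤ × [0,∞)`, since a point at negative
time outside `Λ(r)` is joined to infinity by decreasing its time coordinate.) -/
def IsReplicator (ξ : ℕ → ℤ → Fin 3) (r : ℝ) (η : Ether) : Prop :=
  ∀ K : Set (ℤ × ℤ), IsLatticeComponent (thickWeb r)ᶜ K → Bornology.IsBounded K →
    FilledWith ξ K η

/-- Binary seeds on `[0, L]`; `true` stands for the state `1` and `false` for the state `0`. -/
abbrev BinarySeed (L : ℕ) : Type := Fin (L + 1) → Bool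

/-- The initial configuration given by a binary seed on `[0, L]`, equal to `0` outside `[0, L]`. -/
def BinarySeed.config {L : ℕ} (s : BinarySeed L) : ℤ → Fin 3 :=
  fun x => if ∃ i : Fin (L + 1), ((i : ℕ) : ℤ) = x ∧ s i = true then 1 else 0

/-- The configuration obtained from `ξ` by changing the states on `T` into `2`s. -/
def changeToTwo (ξ : ℤ → Fin 3) (T : Finset ℤ) : ℤ → Fin 3 :=
  fun x => if x ∈ T then 2 else ξ x

/-- The law of a uniformly random binary seed on `[0, L]`. -/
noncomputable def seedLaw (L : ℕ) : Measure (BinarySeed L) :=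
  (PMF.uniformOfFintype (BinarySeed L)).toMeasure

/-! The `1`s evolve on their own, by a rule that is additive mod 2. The proof shows that above each
large void of `Λ` one always sees the same picture, and that all information carried by `2`s is lost
before the void begins.

Self-similarity. Over `ZMod 2`, `2 ^ m` steps act as one step at spacing `2 ^ m`. A long gap in a
row of `Λ` lies in a triangular void, just below a stretch of `…011011…`. If this stretch is long
compared with `2 ^ m`, then `2 ^ m` steps before the void starts the row is `…011011…` dilated by `2
^ m` (`exists_sparsePattern`). By superposition, the evolution from a seed shows there a translate
of `patternRow m`, which depends only on the seed and has period `3 * 2 ^ m`. Bounded components of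
the complement of a thick `Λ` lie deep inside such triangles (`exists_void_triangle`).

Loss of information. Two configurations with the same `1`s can differ later only along an empty
path, a path of allowed steps through non-`1`s (`exists_survives_of_evolve_ne`). If no empty path
crosses the `2 ^ m` rows above the void (`Blocked`), the void's contents are those produced by the
periodic row of `0`s and `1`s, and by pigeonhole these become an ether. Neither the void nor any
added `2`s matter, which gives the replicator with the thickness of the first blocked level.

Probability. For a uniform seed that is long enough, `patternRow m` is uniform on intervals of
length `2 * 2 ^ m`. Conditioning a uniform row on one or two nearby sites leaves the next row
uniform on a slightly smaller interval, so exploring empty paths step by step yields exponential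
decay (`Subcritical`). A union bound over one period makes `Blocked` likely at a large fixed level,
whence tightness.

Positive probability of an ether. Thickness and ether are read off from the pattern rows up to the
first blocked level. These rows take values in a finite group independent of `L`, so any value that
occurs has probability bounded below. -/

/-! ### The additive first level and its doubling identities -/

/-- One step of the *1 Or 3* cellular automaton. -/
def webStep (c : ℤ → ZMod 2) : ℤ → ZMod 2 := fun x => c (x - 1) + c x + c (x + 1)

theorem zmod_two_eq_zero_or_one (a : ZMod 2) : a = 0 ∨ a = 1 := by
  revert a; decide

theorem zmod_two_ne_zero {a : ZMod 2} : a ≠ 0 ↔ a = 1 := by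
  revert a; decide

theorem zmod_two_ne_one {a : ZMod 2} : a ≠ 1 ↔ a = 0 := by
  revert a; decide

theorem webStep_add (c d : ℤ → ZMod 2) : webStep (c + d) = webStep c + webStep d := by
  funext x; simp only [webStep, Pi.add_apply]; ring

theorem webStep_zero : webStep 0 = 0 := by
  funext x; simp [webStep]

theorem webStep_shift (c : ℤ → ZMod 2) (u : ℤ) :
    webStep (fun x => c (x + u)) = fun x => webStep c (x + u) := by
  funext x; simp only [webStep]
  congr 2 <;> ring_nf

theorem webStep_iterate_shift (c : ℤ → ZMod 2) (u : ℤ) (n : ℕ) :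
    webStep^[n] (fun x => c (x + u)) = fun x => webStep^[n] c (x + u) := by
  induction n generalizing c with
  | zero => rfl
  | succ n ih => rw [Function.iterate_succ_apply, webStep_shift, ih, Function.iterate_succ_apply]

/-- Frobenius: in characteristic 2 the `2 ^ m`-th power of `X⁻¹ + 1 + X` has only three terms. -/
theorem webStep_iterate_two_pow (m : ℕ) (c : ℤ → ZMod 2) (x : ℤ) :
    webStep^[2 ^ m] c x = c (x - 2 ^ m) + c x + c (x + 2 ^ m) := by
  induction m generalizing c x with
  | zero => simp [webStep]
  | succ m ih =>
    rw [pow_succ, mul_two, Function.iterate_add_apply, ih, ih, ih, ih]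
    rw [show x - 2 ^ m + 2 ^ m = x by ring, show x + 2 ^ m - 2 ^ m = x by ring,
      show x - 2 ^ m - 2 ^ m = x - 2 ^ (m + 1) by ring,
      show x + 2 ^ m + 2 ^ m = x + 2 ^ (m + 1) by ring]
    have h2 : ∀ a b d e f : ZMod 2, a + b + d + (b + d + e) + (d + e + f) = a + d + f := by decide
    exact h2 _ _ _ _ _

theorem webStep_iterate_congr {n : ℕ} {c d : ℤ → ZMod 2} {a b : ℤ}
    (h : ∀ y, a ≤ y → y ≤ b → c y = d y) :
    ∀ y, a + n ≤ y → y ≤ b - n → webStep^[n] c y = webStep^[n] d y := by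
  induction n with
  | zero => simpa using h
  | succ n ih =>
    intro y h1 h2
    push_cast at h1 h2
    simp only [Function.iterate_succ_apply', webStep]
    rw [ih (y - 1) (by omega) (by omega), ih y (by omega) (by omega),
      ih (y + 1) (by omega) (by omega)]

theorem webStep_iterate_zero (n : ℕ) : webStep^[n] 0 = 0 := by
  induction n with
  | zero => rfl
  | succ n ih => rw [Function.iterate_succ_apply, webStep_zero, ih]

theorem oneOrThreeSingle_add (t n : ℕ) :
    oneOrThreeSingle (t + n) = webStep^[n] (oneOrThreeSingle t) := by
  induction n with
  | zero => rfl
  | succ n ih => rw [Function.iterate_succ_apply', ← ih]; rfl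

theorem oneOrThreeSingle_eq_zero {t : ℕ} {x : ℤ} (h : (t : ℤ) < |x|) :
    oneOrThreeSingle t x = 0 := by
  induction t generalizing x with
  | zero =>
    have : x ≠ 0 := by rintro rfl; simp at h
    simp [oneOrThreeSingle, this]
  | succ t ih =>
    push_cast at h
    simp only [oneOrThreeSingle]
    rw [ih (by rw [lt_abs] at *; omega), ih (by omega), ih (by rw [lt_abs] at *; omega)]
    rfl

theorem oneOrThreeSingle_right (t : ℕ) : oneOrThreeSingle t t = 1 := by
  induction t with
  | zero => simp [oneOrThreeSingle]
  | succ t ih =>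
    simp only [oneOrThreeSingle]
    push_cast
    rw [oneOrThreeSingle_eq_zero (x := (t : ℤ) + 1) (by rw [lt_abs]; omega),
      oneOrThreeSingle_eq_zero (x := (t : ℤ) + 1 + 1) (by rw [lt_abs]; omega),
      add_sub_cancel_right, ih]
    rfl

theorem oneOrThreeSingle_left (t : ℕ) : oneOrThreeSingle t (-t) = 1 := by
  induction t with
  | zero => simp [oneOrThreeSingle]
  | succ t ih =>
    simp only [oneOrThreeSingle]
    push_cast
    rw [oneOrThreeSingle_eq_zero (x := -((t : ℤ) + 1)) (by rw [lt_abs]; omega),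
      oneOrThreeSingle_eq_zero (x := -((t : ℤ) + 1) - 1) (by rw [lt_abs]; omega),
      show -((t : ℤ) + 1) + 1 = -t by ring, ih]
    rfl

theorem oneOrThreeSingle_two_mul_add_two (t : ℕ) (x : ℤ) :
    oneOrThreeSingle (2 * (t + 1)) x = oneOrThreeSingle (2 * t) (x - 2)
      + oneOrThreeSingle (2 * t) x + oneOrThreeSingle (2 * t) (x + 2) := by
  rw [show 2 * (t + 1) = 2 * t + 2 ^ 1 by ring, oneOrThreeSingle_add, webStep_iterate_two_pow]
  norm_num

/-- Squaring a generating polynomial mod 2 replaces `X` by `X²`, so row `2t` is row `t` dilated by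
2. The next two lemmas complete this self-similarity. -/
theorem oneOrThreeSingle_even_odd (t : ℕ) (x : ℤ) :
    oneOrThreeSingle (2 * t) (2 * x + 1) = 0 := by
  induction t generalizing x with
  | zero => simp only [oneOrThreeSingle]; rw [if_neg (by omega)]
  | succ t ih =>
    rw [oneOrThreeSingle_two_mul_add_two, ih, show 2 * x + 1 - 2 = 2 * (x - 1) + 1 by ring,
      show 2 * x + 1 + 2 = 2 * (x + 1) + 1 by ring, ih, ih]
    rfl

theorem oneOrThreeSingle_even_even (t : ℕ) (x : ℤ) :
    oneOrThreeSingle (2 * t) (2 * x) = oneOrThreeSingle t x := by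
  induction t generalizing x with
  | zero => simp [oneOrThreeSingle]
  | succ t ih =>
    rw [oneOrThreeSingle_two_mul_add_two, ih, show 2 * x - 2 = 2 * (x - 1) by ring,
      show 2 * x + 2 = 2 * (x + 1) by ring, ih, ih]
    rfl

theorem oneOrThreeSingle_odd_even (t : ℕ) (x : ℤ) :
    oneOrThreeSingle (2 * t + 1) (2 * x) = oneOrThreeSingle t x := by
  simp only [oneOrThreeSingle]
  rw [show 2 * x - 1 = 2 * (x - 1) + 1 by ring, oneOrThreeSingle_even_odd,
    oneOrThreeSingle_even_odd, oneOrThreeSingle_even_even]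
  simp

theorem oneOrThreeSingle_two_pow_mul (m t : ℕ) (x : ℤ) :
    oneOrThreeSingle (2 ^ m * t) (2 ^ m * x) = oneOrThreeSingle t x := by
  induction m with
  | zero => simp
  | succ m ih =>
    rw [show 2 ^ (m + 1) * t = 2 * (2 ^ m * t) by ring,
      show (2 : ℤ) ^ (m + 1) * x = 2 * (2 ^ m * x) by ring, oneOrThreeSingle_even_even, ih]

theorem oneOrThreeSingle_two_pow_mul_of_not_dvd (m t : ℕ) (x : ℤ) (h : ¬ (2 : ℤ) ^ m ∣ x) :
    oneOrThreeSingle (2 ^ m * t) x = 0 := by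
  induction m generalizing x with
  | zero => simp at h
  | succ m ih =>
    rw [show 2 ^ (m + 1) * t = 2 * (2 ^ m * t) by ring]
    rcases Int.even_or_odd' x with ⟨k, rfl | rfl⟩
    · rw [oneOrThreeSingle_even_even]
      refine ih k fun hk => h ?_
      rw [show (2 : ℤ) ^ (m + 1) = 2 * 2 ^ m by ring]
      exact mul_dvd_mul_left 2 hk
    · exact oneOrThreeSingle_even_odd _ _

/-! ### The rows above a long gap -/

/-- The sequence `…011011…`. -/
def threePattern (z : ℤ) : ZMod 2 := if 3 ∣ z then 0 else 1

/-- `threePattern` on the multiples of `2 ^ m`, and `0` elsewhere. -/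
def sparsePattern (m : ℕ) (x : ℤ) : ZMod 2 :=
  if (2 : ℤ) ^ m ∣ x then threePattern (x / 2 ^ m) else 0

theorem threePattern_sum (z : ℤ) :
    threePattern (z - 1) + threePattern z + threePattern (z + 1) = 0 := by
  unfold threePattern
  split_ifs <;> first | rfl | (exfalso; omega)

theorem threePattern_two_mul_add (y c : ℤ) : threePattern (2 * y + c) = threePattern (y - c) := by
  unfold threePattern
  congr 1
  apply propext
  omega

/-- The condition is a second-order recurrence, so two adjacent values determine `g`; the three
nonzero pairs of initial values are the three phases of `threePattern`. -/
theorem eq_threePattern_of_sum_eq_zero {g : ℤ → ZMod 2} {a b : ℤ}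
    (h : ∀ y, a < y → y < b → g (y - 1) + g y + g (y + 1) = 0) :
    (∀ y, a ≤ y → y ≤ b → g y = 0) ∨ ∃ c, ∀ y, a ≤ y → y ≤ b → g y = threePattern (y + c) := by
  have key : ∀ g' : ℤ → ZMod 2,
      (∀ y, a < y → y < b → g' (y - 1) + g' y + g' (y + 1) = 0) → g a = g' a →
      g (a + 1) = g' (a + 1) → ∀ y, a ≤ y → y ≤ b → g y = g' y := by
    intro g' h' h0 h1
    have : ∀ n : ℕ, (a + n ≤ b → g (a + n) = g' (a + n)) ∧
        (a + n + 1 ≤ b → g (a + n + 1) = g' (a + n + 1)) := by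
      intro n
      induction n with
      | zero => simp [h0, h1]
      | succ n ih =>
        refine ⟨fun hb => ?_, fun hb => ?_⟩
        · push_cast at hb ⊢
          rw [← add_assoc] at hb ⊢
          exact ih.2 hb
        · push_cast at hb ⊢
          have e1 := h (a + n + 1) (by omega) (by omega)
          have e2 := h' (a + n + 1) (by omega) (by omega)
          rw [show a + (n : ℤ) + 1 - 1 = a + n by ring] at e1 e2
          rw [ih.1 (by omega), ih.2 (by omega)] at e1
          rw [← add_assoc]
          have h3 : ∀ p q u v : ZMod 2, p + q + u = 0 → p + q + v = 0 → u = v := by decide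
          exact h3 _ _ _ _ e1 e2
    intro y hy1 hy2
    obtain ⟨n, rfl⟩ : ∃ n : ℕ, y = a + n := ⟨(y - a).toNat, by omega⟩
    exact (this n).1 hy2
  have pat : ∀ c, g a = threePattern (a + c) → g (a + 1) = threePattern (a + 1 + c) →
      ∀ y, a ≤ y → y ≤ b → g y = threePattern (y + c) := by
    intro c h0 h1
    refine key (fun y => threePattern (y + c)) (fun y _ _ => ?_) h0 h1
    have := threePattern_sum (y + c)
    rw [show y - 1 + c = y + c - 1 by ring, show y + 1 + c = y + c + 1 by ring]
    exact this
  rcases zmod_two_eq_zero_or_one (g a) with h0 | h0 <;>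
    rcases zmod_two_eq_zero_or_one (g (a + 1)) with h1 | h1
  · left
    exact key (fun _ => 0) (by simp) h0 h1
  · right
    refine ⟨-a, pat _ ?_ ?_⟩
    · rw [h0, threePattern, if_pos (by omega)]
    · rw [h1, threePattern, if_neg (by omega)]
  · right
    refine ⟨-a + 2, pat _ ?_ ?_⟩
    · rw [h0, threePattern, if_neg (by omega)]
    · rw [h1, threePattern, if_pos (by omega)]
  · right
    refine ⟨-a + 1, pat _ ?_ ?_⟩
    · rw [h0, threePattern, if_neg (by omega)]
    · rw [h1, threePattern, if_neg (by omega)]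

/-- A long stretch of `threePattern` in row `t - 1` of `oneOrThreeSingle` forces `t` to be divisible
by a large power of two. -/
theorem exists_two_pow_mul_of_threePattern (m : ℕ) {t : ℕ} (ht : 1 ≤ t) {a b c : ℤ}
    (hab : a + 8 * 2 ^ m ≤ b)
    (h : ∀ y, a ≤ y → y ≤ b → oneOrThreeSingle (t - 1) y = threePattern (y + c)) :
    ∃ τ : ℕ, 1 ≤ τ ∧ t = 2 ^ m * τ ∧ ∃ c' : ℤ, ∀ y, a ≤ 2 ^ m * y → 2 ^ m * y ≤ b →
      oneOrThreeSingle (τ - 1) y = threePattern (y + c') := by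
  induction m with
  | zero => exact ⟨t, ht, by simp, c, by simpa using h⟩
  | succ m ih =>
    have hpos : (1 : ℤ) ≤ 2 ^ m := one_le_pow₀ (by norm_num)
    have hp : (2 : ℤ) ^ (m + 1) = 2 * 2 ^ m := by ring
    obtain ⟨τ, hτ, rfl, c', hc⟩ := ih (by omega)
    -- If `τ` were odd, row `τ - 1` would be an even row and vanish at all odd sites, but
    -- `threePattern` cannot vanish at two consecutive odd sites. The interval is wide enough to
    -- contain two such sites after dilation by `2 ^ m`.
    have hτe : ∃ σ, τ = 2 * σ := by
      obtain ⟨σ, hσ | hσ⟩ := Nat.even_or_odd' τ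
      · exact ⟨σ, hσ⟩
      exfalso
      subst hσ
      have hz : ∀ z : ℤ, a ≤ 2 ^ m * (2 * z + 1) → 2 ^ m * (2 * z + 1) ≤ b →
          3 ∣ 2 * z + 1 + c' := by
        intro z h1 h2
        have := hc (2 * z + 1) h1 h2
        rw [show 2 * σ + 1 - 1 = 2 * σ by omega, oneOrThreeSingle_even_odd, threePattern] at this
        by_contra h3
        rw [if_neg h3] at this
        exact zero_ne_one this
      set z := a / (2 * 2 ^ m) + 1 with hzdef
      have e1 := Int.emod_add_mul_ediv a (2 * 2 ^ m)
      have e2 := Int.emod_nonneg a (show (2 * 2 ^ m : ℤ) ≠ 0 by omega)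
      have e3 := Int.emod_lt_of_pos a (show (0 : ℤ) < 2 * 2 ^ m by omega)
      have e4 : (2 : ℤ) ^ m * (2 * z + 1) = 2 * 2 ^ m * (a / (2 * 2 ^ m)) + 3 * 2 ^ m := by
        rw [hzdef]; ring
      have e5 : (2 : ℤ) ^ m * (2 * (z + 1) + 1) = 2 * 2 ^ m * (a / (2 * 2 ^ m)) + 5 * 2 ^ m := by
        rw [hzdef]; ring
      have k1 := hz z (by omega) (by omega)
      have k2 := hz (z + 1) (by omega) (by omega)
      omega
    obtain ⟨σ, rfl⟩ := hτe
    refine ⟨σ, by omega, by ring, -c', fun y h1 h2 => ?_⟩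
    rw [hp, mul_assoc, mul_left_comm] at h1 h2
    have := hc (2 * y) h1 h2
    rw [show 2 * σ - 1 = 2 * (σ - 1) + 1 by omega, oneOrThreeSingle_odd_even,
      threePattern_two_mul_add] at this
    rw [this, sub_eq_add_neg]

theorem exists_sparsePattern (m : ℕ) {t : ℕ} (ht : 1 ≤ t) {a b c : ℤ}
    (hab : a + 8 * 2 ^ m ≤ b)
    (h : ∀ y, a ≤ y → y ≤ b → oneOrThreeSingle (t - 1) y = threePattern (y + c)) :
    2 ^ m ≤ t ∧ ∃ u : ℤ, ∀ x, a ≤ x → x ≤ b →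
      oneOrThreeSingle (t - 2 ^ m) x = sparsePattern m (x + u) := by
  obtain ⟨τ, hτ, rfl, c', hc⟩ := exists_two_pow_mul_of_threePattern m ht hab h
  refine ⟨Nat.le_mul_of_pos_right _ hτ, 2 ^ m * c', fun x h1 h2 => ?_⟩
  have he : 2 ^ m * τ - 2 ^ m = 2 ^ m * (τ - 1) := by rw [Nat.mul_sub, mul_one]
  have hne : (2 : ℤ) ^ m ≠ 0 := by positivity
  rw [he, sparsePattern]
  by_cases hd : (2 : ℤ) ^ m ∣ x
  · obtain ⟨y, rfl⟩ := hd
    rw [oneOrThreeSingle_two_pow_mul, hc y h1 h2, ← mul_add, if_pos (dvd_mul_right _ _),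
      Int.mul_ediv_cancel_left _ hne]
  · rw [oneOrThreeSingle_two_pow_mul_of_not_dvd _ _ _ hd, if_neg]
    rwa [Int.dvd_add_left (dvd_mul_right _ _)]

theorem sparsePattern_sum (m : ℕ) (x : ℤ) :
    sparsePattern m (x - 2 ^ m) + sparsePattern m x + sparsePattern m (x + 2 ^ m) = 0 := by
  have hne : (2 : ℤ) ^ m ≠ 0 := by positivity
  unfold sparsePattern
  by_cases hd : (2 : ℤ) ^ m ∣ x
  · obtain ⟨y, rfl⟩ := hd
    rw [show (2 : ℤ) ^ m * y - 2 ^ m = 2 ^ m * (y - 1) by ring,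
      show (2 : ℤ) ^ m * y + 2 ^ m = 2 ^ m * (y + 1) by ring]
    simp only [dvd_mul_right, if_true, Int.mul_ediv_cancel_left _ hne]
    exact threePattern_sum y
  · rw [if_neg hd, if_neg (by rwa [dvd_sub_self_right]),
      if_neg (by rwa [dvd_add_self_right])]
    rfl

theorem webStep_sum_mul {ι : Type*} [Fintype ι] (v : ι → ZMod 2) (p : ι → ℤ) (g : ℤ → ZMod 2)
    (n : ℕ) (x : ℤ) :
    webStep^[n] (fun x => ∑ i, v i * g (x - p i)) x = ∑ i, v i * webStep^[n] g (x - p i) := by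
  induction n generalizing x with
  | zero => rfl
  | succ n ih =>
    simp only [Function.iterate_succ_apply', webStep, ih, ← Finset.sum_add_distrib, ← mul_add]
    refine Finset.sum_congr rfl fun i _ => ?_
    rw [show x - 1 - p i = x - p i - 1 by ring, show x + 1 - p i = x - p i + 1 by ring]

/-! ### Bounded components lie in triangular voids -/

theorem not_mem_thickWeb_iff {r : ℕ} {p : ℤ × ℤ} :
    p ∈ (thickWeb r)ᶜ ↔ ∀ (y : ℤ) (t : ℕ), oneOrThreeSingle t y = 1 →
      (r : ℤ) < |p.1 - y| + |p.2 - t| := by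
  simp only [thickWeb, webSupport, Set.mem_compl_iff, Set.mem_ofPred_eq, not_exists, not_and,
    not_le, l1Dist]
  constructor
  · intro h y t hy
    have := h (y, t) ⟨t, rfl, hy⟩
    exact_mod_cast this
  · rintro h ⟨y, s⟩ ⟨t, hs, hy⟩
    simp only at hs hy
    subst hs
    have := h y t hy
    exact_mod_cast this

theorem IsLatticeComponent.subset {S K : Set (ℤ × ℤ)} (hK : IsLatticeComponent S K) : K ⊆ S := by
  obtain ⟨p, hp, rfl⟩ := hK
  intro q hq
  rcases Relation.ReflTransGen.cases_tail hq with rfl | ⟨_, _, h⟩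
  · exact hp
  · exact h.2

theorem IsLatticeComponent.mem_of_adj {S K : Set (ℤ × ℤ)} (hK : IsLatticeComponent S K)
    {u v : ℤ × ℤ} (hu : u ∈ K) (huv : l1Dist u v = 1) (hv : v ∈ S) : v ∈ K := by
  obtain ⟨p, hp, rfl⟩ := hK
  exact Relation.ReflTransGen.tail hu ⟨huv, hv⟩

/-- A subset of a component that is closed under steps within the component is everything. -/
theorem IsLatticeComponent.induction {S K : Set (ℤ × ℤ)} (hK : IsLatticeComponent S K)
    {P : ℤ × ℤ → Prop} {p : ℤ × ℤ} (hp : p ∈ K) (hP : P p)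
    (hstep : ∀ u v, u ∈ S → v ∈ S → l1Dist u v = 1 → P u → P v) : ∀ q ∈ K, P q := by
  obtain ⟨o, ho, rfl⟩ := hK
  have hsymm : ∀ u v : ℤ × ℤ, l1Dist u v = l1Dist v u := by
    intro u v; simp only [l1Dist, abs_sub_comm]
  have hmem : ∀ q, Relation.ReflTransGen (fun u v => l1Dist u v = 1 ∧ v ∈ S) o q → q ∈ S :=
    fun q hq => IsLatticeComponent.subset ⟨o, ho, rfl⟩ hq
  have hPo : P o := by
    have : ∀ q, Relation.ReflTransGen (fun u v => l1Dist u v = 1 ∧ v ∈ S) o q → P q → P o := by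
      intro q hq
      induction hq with
      | refl => exact id
      | tail h1 h2 ih =>
        exact fun h => ih (hstep _ _ h2.2 (hmem _ h1) ((hsymm _ _).trans h2.1) h)
    exact this p hp hP
  intro q hq
  induction hq with
  | refl => exact hPo
  | tail h1 h2 ih => exact hstep _ _ (hmem _ h1) h2.2 h2.1 ih

theorem exists_abs_fst_le_of_isBounded {K : Set (ℤ × ℤ)} (hb : Bornology.IsBounded K) :
    ∃ C : ℤ, ∀ q ∈ K, |q.1| ≤ C := by
  obtain ⟨C, hC⟩ := hb.exists_norm_le
  refine ⟨⌈C⌉, fun q hq => ?_⟩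
  have h1 : ‖q.1‖ ≤ C := (norm_fst_le q).trans (hC q hq)
  rw [Int.norm_eq_abs] at h1
  have h2 : (|(q.1 : ℝ)|) ≤ ⌈C⌉ := h1.trans (Int.le_ceil C)
  exact_mod_cast h2

/-- `Λ` lies in the light cone, so from a point outside it one can walk horizontally to infinity
without coming closer to `Λ`. -/
theorem abs_lt_of_mem_bounded_component {r : ℕ} {K : Set (ℤ × ℤ)}
    (hK : IsLatticeComponent (thickWeb r)ᶜ K) (hb : Bornology.IsBounded K) {x : ℤ} {t : ℕ}
    (hx : (x, (t : ℤ)) ∈ K) : |x| < t := by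
  obtain ⟨C, hC⟩ := exists_abs_fst_le_of_isBounded hb
  have hsupp : ∀ (y : ℤ) (s : ℕ), oneOrThreeSingle s y = 1 → |y| ≤ s := by
    intro y s h
    by_contra hlt
    rw [oneOrThreeSingle_eq_zero (not_le.mp hlt)] at h
    exact zero_ne_one h
  have hx0 := not_mem_thickWeb_iff.mp (hK.subset hx)
  rw [abs_lt]
  refine ⟨lt_of_not_ge fun hle => ?_, lt_of_not_ge fun hle => ?_⟩
  · have h0 := hx0 (-t) t (oneOrThreeSingle_left t)
    simp only [sub_self, abs_zero, add_zero] at h0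
    have key : ∀ j : ℕ, (x - j, (t : ℤ)) ∈ K := by
      intro j
      induction j with
      | zero => simpa using hx
      | succ j ih =>
        refine hK.mem_of_adj ih ?_ (not_mem_thickWeb_iff.mpr fun y s hy => ?_)
        · simp [l1Dist]
        · have h1 := abs_le.mp (hsupp y s hy)
          have h2 := neg_abs_le (x - ((j + 1 : ℕ) : ℤ) - y)
          have h3 := neg_abs_le ((t : ℤ) - s)
          rw [abs_of_nonpos (by omega)] at h0
          push_cast at *
          linarith
    have h1 := hC _ (key (C + x).toNat.succ)
    have h2 := neg_abs_le (x - ((C + x).toNat.succ : ℤ))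
    simp only [Nat.succ_eq_add_one] at h1 h2
    push_cast at *
    omega
  · have h0 := hx0 t t (oneOrThreeSingle_right t)
    simp only [sub_self, abs_zero, add_zero] at h0
    have key : ∀ j : ℕ, (x + j, (t : ℤ)) ∈ K := by
      intro j
      induction j with
      | zero => simpa using hx
      | succ j ih =>
        refine hK.mem_of_adj ih ?_ (not_mem_thickWeb_iff.mpr fun y s hy => ?_)
        · simp [l1Dist]
        · have h1 := abs_le.mp (hsupp y s hy)
          have h2 := le_abs_self (x + ((j + 1 : ℕ) : ℤ) - y)
          have h3 := neg_abs_le ((t : ℤ) - s)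
          rw [abs_of_nonneg (by omega)] at h0
          push_cast at *
          linarith
    have h1 := hC _ (key (C - x).toNat.succ)
    have h2 := le_abs_self (x + ((C - x).toNat.succ : ℤ))
    simp only [Nat.succ_eq_add_one] at h1 h2
    push_cast at *
    omega

theorem exists_last_one_left {g : ℤ → ZMod 2} {x : ℤ} (hx : g x = 0) {z : ℤ} (hz : z ≤ x)
    (hgz : g z = 1) : ∃ a < x, g a = 1 ∧ ∀ y, a < y → y ≤ x → g y = 0 := by
  classical
  have hex : ∃ n : ℕ, g (x - n) = 1 := ⟨(x - z).toNat, by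
    rw [show x - ((x - z).toNat : ℤ) = z by omega]; exact hgz⟩
  have hs := Nat.find_spec hex
  refine ⟨x - Nat.find hex, ?_, hs, fun y h1 h2 => ?_⟩
  · have : Nat.find hex ≠ 0 := by
      intro h0
      rw [h0] at hs
      simp [hx] at hs
    omega
  · have hm := Nat.find_min hex (m := (x - y).toNat) (by omega)
    rw [show x - ((x - y).toNat : ℤ) = y by omega] at hm
    exact zmod_two_ne_one.mp hm

theorem exists_first_one_right {g : ℤ → ZMod 2} {x : ℤ} (hx : g x = 0) {z : ℤ} (hz : x ≤ z)
    (hgz : g z = 1) : ∃ b > x, g b = 1 ∧ ∀ y, x ≤ y → y < b → g y = 0 := by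
  obtain ⟨a, h1, h2, h3⟩ := exists_last_one_left (g := fun y => g (-y)) (x := -x) (z := -z)
    (by simpa using hx) (by omega) (by simpa using hgz)
  refine ⟨-a, by omega, h2, fun y hy1 hy2 => ?_⟩
  simpa using h3 (-y) (by omega) (by omega)

/-- A long gap in a row of `oneOrThreeSingle` belongs to a triangular void, immediately below a row
of `threePattern`. -/
theorem exists_void_top {t : ℕ} {a b : ℤ} (hab : a + 3 ≤ b) (ha : oneOrThreeSingle t a = 1)
    (hb : oneOrThreeSingle t b = 1) (h : ∀ y, a < y → y < b → oneOrThreeSingle t y = 0) :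
    ∃ k t₀ : ℕ, t = t₀ + k ∧ 1 ≤ t₀ ∧ oneOrThreeSingle t₀ (a - k) = 1 ∧
      oneOrThreeSingle t₀ (b + k) = 1 ∧
      (∀ y, a - k < y → y < b + k → oneOrThreeSingle t₀ y = 0) ∧
      ∃ c, ∀ y, a - k ≤ y → y ≤ b + k →
        oneOrThreeSingle (t₀ - 1) y = threePattern (y + c) := by
  induction t generalizing a b with
  | zero =>
    simp only [oneOrThreeSingle] at ha hb
    split_ifs at ha hb with h1 h2
    · omega
    all_goals simp_all
  | succ t ih =>
    rcases eq_threePattern_of_sum_eq_zero (g := oneOrThreeSingle t) (a := a) (b := b) h with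
      h0 | ⟨c, hc⟩
    -- If the previous row also vanishes on the interval, the gap there is wider by one site on each
    -- side, and the ascent continues; it cannot reach row `0`, which has a single `1`.
    · have ha' : oneOrThreeSingle t (a - 1) = 1 := by
        simp only [oneOrThreeSingle] at ha
        rw [h0 a (by omega) (by omega), h0 (a + 1) (by omega) (by omega)] at ha
        simpa using ha
      have hb' : oneOrThreeSingle t (b + 1) = 1 := by
        simp only [oneOrThreeSingle] at hb
        rw [h0 b (by omega) (by omega), h0 (b - 1) (by omega) (by omega)] at hb
        simpa using hb
      obtain ⟨k, t₀, rfl, h1, h2, h3, h4, c, h5⟩ := ih (a := a - 1) (b := b + 1) (by omega) ha' hb'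
        (fun y h1 h2 => h0 y (by omega) (by omega))
      have e1 : a - ((k + 1 : ℕ) : ℤ) = a - 1 - k := by push_cast; ring
      have e2 : b + ((k + 1 : ℕ) : ℤ) = b + 1 + k := by push_cast; ring
      refine ⟨k + 1, t₀, rfl, h1, ?_⟩
      rw [e1, e2]
      exact ⟨h2, h3, h4, c, h5⟩
    · refine ⟨0, t + 1, rfl, by omega, by simpa using ha, by simpa using hb,
        by simpa using h, c, ?_⟩
      simpa using hc

theorem void_sides {t₀ : ℕ} {a b : ℤ} (ha : oneOrThreeSingle t₀ a = 1)
    (hb : oneOrThreeSingle t₀ b = 1) (h : ∀ y, a < y → y < b → oneOrThreeSingle t₀ y = 0)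
    (k : ℕ) (hk : a + k + 1 ≤ b - k) :
    oneOrThreeSingle (t₀ + k) (a + k) = 1 ∧ oneOrThreeSingle (t₀ + k) (b - k) = 1 ∧
      ∀ y, a + k < y → y < b - k → oneOrThreeSingle (t₀ + k) y = 0 := by
  induction k with
  | zero => simpa using ⟨ha, hb, h⟩
  | succ k ih =>
    push_cast at hk ⊢
    obtain ⟨h1, h2, h3⟩ := ih (by omega)
    rw [← add_assoc]
    simp only [oneOrThreeSingle]
    refine ⟨?_, ?_, fun y hy1 hy2 => ?_⟩
    · rw [h3 (a + (k + 1)) (by omega) (by omega), h3 (a + (k + 1) + 1) (by omega) (by omega),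
        show a + ((k : ℤ) + 1) - 1 = a + k by ring, h1]
      rfl
    · rw [h3 (b - (k + 1)) (by omega) (by omega), h3 (b - (k + 1) - 1) (by omega) (by omega),
        show b - ((k : ℤ) + 1) + 1 = b - k by ring, h2]
      rfl
    · rw [h3 _ (by omega) (by omega), h3 _ (by omega) (by omega), h3 _ (by omega) (by omega)]
      rfl

/-- The two slanted sides of the void consist of `1`s, and the row above it has a `1` among any two
adjacent sites. The thickening of this boundary cannot be crossed, so the component stays in the
triangle at distance more than `r` from its boundary. -/
theorem exists_void_triangle {r : ℕ} (hr : 3 ≤ r) {K : Set (ℤ × ℤ)}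
    (hK : IsLatticeComponent (thickWeb r)ᶜ K) (hb : Bornology.IsBounded K) {x : ℤ} {t : ℕ}
    (hx : (x, (t : ℤ)) ∈ K) :
    ∃ (a b c : ℤ) (t₀ : ℕ), 1 ≤ t₀ ∧ (∀ y, a < y → y < b → oneOrThreeSingle t₀ y = 0) ∧
      (∀ y, a ≤ y → y ≤ b → oneOrThreeSingle (t₀ - 1) y = threePattern (y + c)) ∧
      ∀ q ∈ K, ∃ k : ℕ, q.2 = t₀ + k ∧ a + k + r < q.1 ∧ q.1 < b - k - r ∧ r < k + 2 := by
  have hxt := abs_lt.mp (abs_lt_of_mem_bounded_component hK hb hx)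
  have hx0 := not_mem_thickWeb_iff.mp (hK.subset hx)
  have hzero : oneOrThreeSingle t x = 0 := by
    rw [← zmod_two_ne_one]
    intro h
    have := hx0 x t h
    simp at this
    omega
  obtain ⟨a', ha', ha1, ha2⟩ := exists_last_one_left hzero (z := -t) (by omega)
    (oneOrThreeSingle_left t)
  obtain ⟨b', hb', hb1, hb2⟩ := exists_first_one_right hzero (z := t) (by omega)
    (oneOrThreeSingle_right t)
  have hda := hx0 a' t ha1
  have hdb := hx0 b' t hb1
  simp only [sub_self, abs_zero, add_zero] at hda hdb
  rw [abs_of_pos (by omega)] at hda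
  rw [abs_of_neg (by omega)] at hdb
  obtain ⟨k₀, t₀, rfl, h1, h2, h3, h4, c, h5⟩ := exists_void_top (t := t) (a := a') (b := b')
    (by omega) ha1 hb1 (fun y hy1 hy2 => by
      rcases le_total y x with hyx | hyx
      · exact ha2 y hy1 hyx
      · exact hb2 y hyx hy2)
  refine ⟨a' - k₀, b' + k₀, c, t₀, h1, h4, h5, ?_⟩
  set a := a' - (k₀ : ℤ) with hadef
  set b := b' + (k₀ : ℤ) with hbdef
  have hsides := void_sides h2 h3 h4
  have hpat : ∀ y, a ≤ y → y + 1 ≤ b → ∃ z, (z = y ∨ z = y + 1) ∧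
      oneOrThreeSingle (t₀ - 1) z = 1 := by
    intro y hy1 hy2
    by_cases hd : 3 ∣ y + c
    · refine ⟨y + 1, Or.inr rfl, ?_⟩
      rw [h5 _ (by omega) hy2, threePattern, if_neg (by omega)]
    · refine ⟨y, Or.inl rfl, ?_⟩
      rw [h5 _ hy1 (by omega), threePattern, if_neg hd]
  have hin : ∀ q ∈ K, ∃ k : ℕ, q.2 = t₀ + k ∧ a + k < q.1 ∧ q.1 < b - k := by
    refine hK.induction hx ⟨k₀, by push_cast; rfl, by simp only; omega, by simp only; omega⟩ ?_
    rintro ⟨u1, u2⟩ ⟨v1, v2⟩ - hv huv ⟨k, hk, hk1, hk2⟩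
    rw [not_mem_thickWeb_iff] at hv
    simp only [l1Dist] at hv huv hk hk1 hk2 ⊢
    obtain ⟨s1, s2, -⟩ := hsides k (by omega)
    have d1 := hv _ _ s1
    have d2 := hv _ _ s2
    push_cast at d1 d2
    rcases eq_or_ne v2 u2 with he | he
    · refine ⟨k, by omega, ?_, ?_⟩
      · by_contra hcon
        subst he
        rw [abs_eq_max_neg, abs_eq_max_neg] at d1 huv
        omega
      · by_contra hcon
        subst he
        rw [abs_eq_max_neg, abs_eq_max_neg] at d2 huv
        omega
    · have hv1 : v1 = u1 := by
        rw [abs_eq_max_neg, abs_eq_max_neg] at huv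
        omega
      subst hv1
      have hv2 : v2 = u2 + 1 ∨ v2 = u2 - 1 := by
        rw [abs_eq_max_neg, abs_eq_max_neg] at huv
        omega
      rcases hv2 with rfl | rfl
      · refine ⟨k + 1, by push_cast; omega, ?_, ?_⟩
        · by_contra hcon
          rw [abs_eq_max_neg, abs_eq_max_neg] at d1
          push_cast at hcon
          omega
        · by_contra hcon
          rw [abs_eq_max_neg, abs_eq_max_neg] at d2
          push_cast at hcon
          omega
      · rcases Nat.eq_zero_or_pos k with rfl | hkpos
        · exfalso
          obtain ⟨z, hz, hz1⟩ := hpat v1 (by omega) (by omega)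
          have d3 := hv _ _ hz1
          rw [abs_eq_max_neg, abs_eq_max_neg] at d3
          push_cast [h1] at d3
          omega
        · exact ⟨k - 1, by omega, by omega, by omega⟩
  intro q hq
  obtain ⟨k, hk, hk1, hk2⟩ := hin q hq
  have hv := not_mem_thickWeb_iff.mp (hK.subset hq)
  obtain ⟨s1, s2, -⟩ := hsides k (by omega)
  have d1 := hv _ _ s1
  have d2 := hv _ _ s2
  obtain ⟨z, hz, hz1⟩ := hpat q.1 (by omega) (by omega)
  have d3 := hv _ _ hz1
  rw [abs_eq_max_neg, abs_eq_max_neg] at d1 d2 d3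
  push_cast [h1] at d1 d2 d3
  -- The bound `r < k + 2` comes from a `1` of row `t₀ - 1`, at vertical distance `k + 1` and
  -- horizontal distance at most `1`.
  exact ⟨k, hk, by omega, by omega, by omega⟩

/-! ### The second level: discrepancies travel along empty paths -/

/-- The first level of a configuration: the indicator of its `1`s. -/
def firstLevel (ξ : ℤ → Fin 3) : ℤ → ZMod 2 := fun x => CARule.delta (ξ x)

/-- The configuration of `0`s and `1`s with a given first level. -/
def binaryConfig (c : ℤ → ZMod 2) : ℤ → Fin 3 := fun x => if c x = 1 then 1 else 0

theorem firstLevel_binaryConfig (c : ℤ → ZMod 2) : firstLevel (binaryConfig c) = c := by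
  funext x
  unfold firstLevel binaryConfig CARule.delta
  rcases zmod_two_eq_zero_or_one (c x) with h | h <;> simp [h]

theorem binaryConfig_ne_two (c : ℤ → ZMod 2) (x : ℤ) : binaryConfig c x ≠ 2 := by
  unfold binaryConfig; split_ifs <;> decide

theorem delta_eq_zero_of_ne {a b : Fin 3} (h : CARule.delta a = CARule.delta b) (hne : a ≠ b) :
    CARule.delta a = 0 := by
  revert a b; decide

theorem ne_one_of_delta_eq_zero {a : Fin 3} (h : CARule.delta a = 0) : a ≠ 1 := by
  revert a; decide

theorem eq_one_of_delta_eq_one {a : Fin 3} (h : CARule.delta a = 1) : a = 1 := by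
  revert a; decide

namespace CARule

variable {f : CARule}

theorem firstLevel_step (hf : f.IsWeb) (ξ : ℤ → Fin 3) :
    firstLevel (f.step ξ) = webStep (firstLevel ξ) := by
  funext x
  exact hf.first_level _ _ _ _ _

theorem firstLevel_evolve (hf : f.IsWeb) (ξ : ℤ → Fin 3) (n : ℕ) :
    firstLevel (f.evolve ξ n) = webStep^[n] (firstLevel ξ) := by
  induction n with
  | zero => rfl
  | succ n ih => rw [Function.iterate_succ_apply', ← ih, ← firstLevel_step hf]; rfl

theorem evolve_add (f : CARule) (ξ : ℤ → Fin 3) (m n : ℕ) :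
    f.evolve ξ (m + n) = f.evolve (f.evolve ξ m) n := by
  induction n with
  | zero => rfl
  | succ n ih => exact congrArg f.step ih

theorem evolve_succ (f : CARule) (ξ : ℤ → Fin 3) (n : ℕ) :
    f.evolve ξ (n + 1) = f.evolve (f.step ξ) n := by
  rw [add_comm, evolve_add]; rfl

theorem evolve_shift (f : CARule) (ξ : ℤ → Fin 3) (u : ℤ) (n : ℕ) :
    f.evolve (fun x => ξ (x + u)) n = fun x => f.evolve ξ n (x + u) := by
  induction n with
  | zero => rfl
  | succ n ih =>
    funext x
    simp only [evolve, ih, step]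
    congr 2 <;> ring_nf

theorem DiagonalCompliant.emptyCompliant (h : f.DiagonalCompliant) : f.EmptyCompliant :=
  fun _ _ _ _ _ _ _ ha he => h _ _ _ _ _ _ _ _ ha rfl he

/-- `f` transmits second-level discrepancies only along steps of the relation `S`, which may depend
on the first level. -/
def Transmits (f : CARule) (S : (ℤ → ZMod 2) → ℤ → ℤ → Prop) : Prop :=
  ∀ (ξ ξ' : ℤ → Fin 3) (c : ℤ → ZMod 2) (x : ℤ),
    (∀ y, x - 2 ≤ y → y ≤ x + 2 → delta (ξ y) = c y ∧ delta (ξ' y) = c y) →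
    f.step ξ x ≠ f.step ξ' x → ∃ y, x - 1 ≤ y ∧ y ≤ x + 1 ∧ ξ y ≠ ξ' y ∧ S c y x

end CARule

/-- The row `c` starts an empty path of length `n` at `x`: a sequence of `n` steps of `S`, forward
in time, visiting only `0`s of the *1 Or 3* evolution of `c`. -/
def Survives (S : (ℤ → ZMod 2) → ℤ → ℤ → Prop) : ℕ → (ℤ → ZMod 2) → ℤ → Prop
  | 0, c, x => c x = 0
  | n + 1, c, x => c x = 0 ∧ ∃ y, S c x y ∧ Survives S n (webStep c) y

/-- Diagonal steps. -/
def diagonalStep (_ : ℤ → ZMod 2) (x y : ℤ) : Prop := y = x - 1 ∨ y = x + 1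

/-- Wide steps: a diagonal step must have a `0` on one of its two sides. -/
def wideStep (c : ℤ → ZMod 2) (x y : ℤ) : Prop :=
  y = x ∨ (y = x - 1 ∨ y = x + 1) ∧ ¬ (c y = 1 ∧ webStep c x = 1)

/-- Shift invariance of a step relation. -/
def ShiftInvariant (S : (ℤ → ZMod 2) → ℤ → ℤ → Prop) : Prop :=
  ∀ c u x y, S (fun z => c (z + u)) x y → S c (x + u) (y + u)

theorem diagonalStep_shiftInvariant : ShiftInvariant diagonalStep := by
  intro c u x y h
  unfold diagonalStep at *
  omega

theorem wideStep_shiftInvariant : ShiftInvariant wideStep := by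
  intro c u x y h
  unfold wideStep at *
  rw [webStep_shift] at h
  refine h.imp (fun h => by rw [h]) fun h => ⟨?_, h.2⟩
  have := h.1
  omega

theorem ShiftInvariant.survives {S : (ℤ → ZMod 2) → ℤ → ℤ → Prop} (hS : ShiftInvariant S)
    {n : ℕ} {c : ℤ → ZMod 2} {u x : ℤ} (h : Survives S n (fun z => c (z + u)) x) :
    Survives S n c (x + u) := by
  induction n generalizing c x with
  | zero => exact h
  | succ n ih =>
    obtain ⟨h0, y, h1, h2⟩ := h
    rw [webStep_shift] at h2
    exact ⟨h0, y + u, hS _ _ _ _ h1, ih h2⟩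

theorem Survives.mono {S : (ℤ → ZMod 2) → ℤ → ℤ → Prop} {n k : ℕ} (hk : k ≤ n)
    {c : ℤ → ZMod 2} {x : ℤ} (h : Survives S n c x) : Survives S k c x := by
  induction n generalizing k c x with
  | zero => obtain rfl : k = 0 := by omega
            exact h
  | succ n ih =>
    obtain ⟨h0, y, h1, h2⟩ := h
    cases k with
    | zero => exact h0
    | succ k => exact ⟨h0, y, h1, ih (by omega) h2⟩

namespace CARule

variable {f : CARule}

theorem DiagonalCompliant.transmits (h : f.DiagonalCompliant) : f.Transmits diagonalStep := by
  intro ξ ξ' c x hc hne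
  by_contra! hcon
  refine hne ?_
  have h1 : ξ (x - 1) = ξ' (x - 1) := by
    by_contra hd
    exact hcon (x - 1) (by omega) (by omega) hd (Or.inr (by ring))
  have h2 : ξ (x + 1) = ξ' (x + 1) := by
    by_contra hd
    exact hcon (x + 1) (by omega) (by omega) hd (Or.inl (by ring))
  have hd : ∀ y, x - 2 ≤ y → y ≤ x + 2 → delta (ξ y) = delta (ξ' y) :=
    fun y a b => (hc y a b).1.trans (hc y a b).2.symm
  simp only [step, h1, h2]
  exact h _ _ _ _ _ _ _ _ (hd _ (by omega) (by omega)) (hd _ (by omega) (by omega))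
    (hd _ (by omega) (by omega))

/-- A diagonal step is forbidden exactly when the `left` or `right` clause applies. The left
neighbour and the outer cells are exchanged first, then the right neighbour. -/
theorem WideCompliant.transmits (h : f.WideCompliant) : f.Transmits wideStep := by
  intro ξ ξ' c x hc hne
  by_contra! hcon
  refine hne ?_
  have h0 : ξ x = ξ' x := by
    by_contra hd
    exact hcon x (by omega) (by omega) hd (Or.inl rfl)
  have hd : ∀ y, x - 2 ≤ y → y ≤ x + 2 → delta (ξ y) = delta (ξ' y) :=
    fun y a b => (hc y a b).1.trans (hc y a b).2.symm
  have hl : ξ (x - 1) = ξ' (x - 1) ∨ (c x = 1 ∧ webStep c (x - 1) = 1) := by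
    by_contra! hd
    refine hcon (x - 1) (by omega) (by omega) hd.1 (Or.inr ⟨Or.inr (by ring), ?_⟩)
    exact fun hh => hd.2 hh.1 hh.2
  have hr : ξ (x + 1) = ξ' (x + 1) ∨ (c x = 1 ∧ webStep c (x + 1) = 1) := by
    by_contra! hd
    refine hcon (x + 1) (by omega) (by omega) hd.1 (Or.inr ⟨Or.inl (by ring), ?_⟩)
    exact fun hh => hd.2 hh.1 hh.2
  have d1 := hd (x - 2) (by omega) (by omega)
  have d2 := hd (x - 1) (by omega) (by omega)
  have d3 := hd (x + 1) (by omega) (by omega)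
  have d4 := hd (x + 2) (by omega) (by omega)
  have c0 := hc x (by omega) (by omega)
  have e1 : f (ξ (x - 2)) (ξ (x - 1)) (ξ x) (ξ (x + 1)) (ξ (x + 2)) =
      f (ξ' (x - 2)) (ξ' (x - 1)) (ξ x) (ξ (x + 1)) (ξ' (x + 2)) := by
    rcases hl with hl | ⟨hl1, hl2⟩
    · rw [← hl]; exact h.empty _ _ _ _ _ _ _ d1 d4
    · refine h.left _ _ _ _ _ _ _ _ d1 d2 d4 (eq_one_of_delta_eq_one (c0.1.trans hl1)) ?_
      rw [(hc _ _ _).1, (hc _ _ _).1, (hc _ _ _).1]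
      · simp only [webStep] at hl2
        rwa [sub_add_cancel, show x - 1 - 1 = x - 2 by ring] at hl2
      all_goals omega
  have e2 : f (ξ' (x - 2)) (ξ' (x - 1)) (ξ x) (ξ (x + 1)) (ξ' (x + 2)) =
      f (ξ' (x - 2)) (ξ' (x - 1)) (ξ x) (ξ' (x + 1)) (ξ' (x + 2)) := by
    rcases hr with hr | ⟨hr1, hr2⟩
    · rw [← hr]
    · refine h.right _ _ _ _ _ _ _ _ rfl d3 rfl (eq_one_of_delta_eq_one (c0.1.trans hr1)) ?_
      rw [(hc _ _ _).1, (hc _ _ _).1, (hc _ _ _).2]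
      · simp only [webStep] at hr2
        rwa [add_sub_cancel_right, show x + 1 + 1 = x + 2 by ring] at hr2
      all_goals omega
  simp only [step]
  rw [e1, e2, h0]

/-- A discrepancy is traced back one row at a time. It can sit only at a `0` of the first level,
since equal first levels equal to `1` force equal states. -/
theorem exists_survives_of_evolve_ne (hf : f.IsWeb) {S : (ℤ → ZMod 2) → ℤ → ℤ → Prop}
    (hT : f.Transmits S) {n : ℕ} {ξ ξ' : ℤ → Fin 3} {c : ℤ → ZMod 2} {x : ℤ}
    (hc : ∀ y, x - 2 * n ≤ y → y ≤ x + 2 * n → delta (ξ y) = c y ∧ delta (ξ' y) = c y)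
    (hne : f.evolve ξ n x ≠ f.evolve ξ' n x) :
    ∃ y, x - n ≤ y ∧ y ≤ x + n ∧ ξ y ≠ ξ' y ∧ Survives S n c y := by
  have zero : ∀ y, x - 2 * n ≤ y → y ≤ x + 2 * n → ξ y ≠ ξ' y → c y = 0 := by
    intro y h1 h2 h3
    obtain ⟨h4, h5⟩ := hc y h1 h2
    rw [← h4]
    exact delta_eq_zero_of_ne (h4.trans h5.symm) h3
  induction n generalizing ξ ξ' c with
  | zero => exact ⟨x, by simp, by simp, hne, zero x (by simp) (by simp) hne⟩
  | succ n ih =>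
    push_cast at hc zero
    rw [evolve_succ, evolve_succ] at hne
    have hstep : ∀ y, x - 2 * n ≤ y → y ≤ x + 2 * n →
        delta (f.step ξ y) = webStep c y ∧ delta (f.step ξ' y) = webStep c y := by
      intro y h1 h2
      have e1 : ∀ ζ : ℤ → Fin 3, delta (f.step ζ y) =
          delta (ζ (y - 1)) + delta (ζ y) + delta (ζ (y + 1)) := by
        intro ζ; exact hf.first_level _ _ _ _ _
      rw [e1, e1, (hc (y - 1) (by omega) (by omega)).1, (hc y (by omega) (by omega)).1,
        (hc (y + 1) (by omega) (by omega)).1, (hc (y - 1) (by omega) (by omega)).2,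
        (hc y (by omega) (by omega)).2, (hc (y + 1) (by omega) (by omega)).2]
      exact ⟨rfl, rfl⟩
    obtain ⟨y, h1, h2, h3, h4⟩ := ih hstep hne (by
      intro y h1 h2 h3
      obtain ⟨h4, h5⟩ := hstep y h1 h2
      rw [← h4]
      exact delta_eq_zero_of_ne (h4.trans h5.symm) h3)
    obtain ⟨z, g1, g2, g3, g4⟩ := hT ξ ξ' c y (fun z _ _ => hc z (by omega) (by omega)) h3
    push_cast
    exact ⟨z, by omega, by omega, g3, zero z (by omega) (by omega) g3, y, g4, h4⟩

/-- If no empty path crosses the rows `0, …, n` of the evolution of `c`, after which `c` vanishes,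
then the evolution of a configuration whose first level agrees with `c` on an interval is
eventually the same as that of the binary configuration `c`, on the void below that interval. -/
theorem evolve_eq_of_not_survives (hf : f.IsWeb) (he : f.EmptyCompliant)
    {S : (ℤ → ZMod 2) → ℤ → ℤ → Prop} (hT : f.Transmits S) (hS : ShiftInvariant S)
    {n : ℕ} (hn : 1 ≤ n) {c : ℤ → ZMod 2} (hblock : ∀ x, ¬ Survives S n c x)
    (hzero : webStep^[n] c = 0) {ζ : ℤ → Fin 3} {u a b : ℤ}
    (hζ : ∀ x, a ≤ x → x ≤ b → delta (ζ x) = c (x + u)) (k : ℕ) :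
    ∀ x, a + 2 * n + k ≤ x → x ≤ b - 2 * n - k →
      f.evolve ζ (n + k) x = f.evolve (binaryConfig c) (n + k) (x + u) := by
  have hlev : ∀ k : ℕ, ∀ x, a + n + k ≤ x → x ≤ b - n - k →
      delta (f.evolve ζ (n + k) x) = 0 := by
    intro k x h1 h2
    have e1 : delta (f.evolve ζ (n + k) x) = webStep^[n + k] (firstLevel ζ) x :=
      congrFun (firstLevel_evolve hf ζ (n + k)) x
    have e2 := webStep_iterate_congr (n := n + k) (c := firstLevel ζ)
      (d := fun x => c (x + u)) hζ x (by push_cast; omega) (by push_cast; omega)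
    rw [e1, e2, webStep_iterate_shift, add_comm n k, Function.iterate_add_apply, hzero,
      webStep_iterate_zero]
    rfl
  have hlev' : ∀ k : ℕ, ∀ x, delta (f.evolve (binaryConfig c) (n + k) x) = 0 := by
    intro k x
    have e1 : delta (f.evolve (binaryConfig c) (n + k) x) =
        webStep^[n + k] (firstLevel (binaryConfig c)) x :=
      congrFun (firstLevel_evolve hf _ (n + k)) x
    rw [e1, firstLevel_binaryConfig, add_comm n k, Function.iterate_add_apply, hzero,
      webStep_iterate_zero]
    rfl
  induction k with
  | zero =>
    intro x h1 h2
    simp only [Nat.cast_zero, add_zero, sub_zero] at h1 h2 ⊢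
    have e := congrFun (evolve_shift f (binaryConfig c) u n) x
    rw [← e]
    by_contra hne
    obtain ⟨y, -, -, -, hy⟩ := exists_survives_of_evolve_ne hf hT
      (c := fun x => c (x + u)) (fun y h3 h4 => ⟨hζ y (by omega) (by omega), by
        exact congrFun (firstLevel_binaryConfig c) (y + u)⟩) hne
    exact hblock _ (hS.survives hy)
  | succ k ih =>
    intro x h1 h2
    push_cast at h1 h2
    rw [← add_assoc]
    change f.step (f.evolve ζ (n + k)) x = f.step (f.evolve (binaryConfig c) (n + k)) (x + u)
    simp only [step]
    rw [ih (x - 1) (by omega) (by omega), ih x (by omega) (by omega),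
      ih (x + 1) (by omega) (by omega), show x - 1 + u = x + u - 1 by ring,
      show x + 1 + u = x + u + 1 by ring]
    -- Both outer cells have first level `0` in both evolutions, so by empty compliance only the
    -- three central cells matter; the margin therefore grows by just one site per step.
    apply he
    · rw [hlev k (x - 2) (by omega) (by omega), hlev' k]
    · rw [hlev k (x + 2) (by omega) (by omega), hlev' k]

theorem evolve_periodic (f : CARule) {ξ : ℤ → Fin 3} {p : ℤ} (h : ∀ x, ξ (x + p) = ξ x)
    (n : ℕ) (x : ℤ) : f.evolve ξ n (x + p) = f.evolve ξ n x := by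
  have := congrFun (evolve_shift f ξ p n) x
  rw [funext h] at this
  exact this.symm

/-- The evolution of a spatially periodic configuration without `1`s is eventually an ether. -/
theorem exists_ether (f : CARule) {ξ : ℤ → Fin 3} {p : ℕ} (hp : 0 < p)
    (hper : ∀ x, ξ (x + p) = ξ x) (hone : ∀ k x, f.evolve ξ k x ≠ 1) :
    ∃ η : Ether, ((∀ k x, f.evolve ξ k x = 0) → ∀ x t, η.val x t = 0) ∧
      ∀ k, 3 ^ p ≤ k → ∀ x, f.evolve ξ k x = η.val x k := by
  have hmod : ∀ k x, f.evolve ξ k x = f.evolve ξ k (x % p) := by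
    intro k x
    have h1 : ∀ n : ℤ, f.evolve ξ k (x + n * p) = f.evolve ξ k x := by
      intro n
      have : Function.Periodic (f.evolve ξ k) (p : ℤ) := evolve_periodic f hper k
      exact this.int_mul n x
    rw [← h1 (-(x / p)), Int.emod_def]
    congr 1; ring
  -- A row of period `p` is one of at most `3 ^ p`, so two of the first `3 ^ p + 1` rows coincide.
  obtain ⟨i, j, hij, hi, heq⟩ : ∃ i j : ℕ, i < j ∧ i ≤ 3 ^ p ∧ f.evolve ξ i = f.evolve ξ j := by
    obtain ⟨i, j, hne, he⟩ := Fintype.exists_ne_map_eq_of_card_lt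
      (fun (k : Fin (3 ^ p + 1)) (y : Fin p) => f.evolve ξ k (y : ℤ)) (by simp)
    have hfe : f.evolve ξ i = f.evolve ξ j := by
      funext x
      rw [hmod, hmod (j : ℕ)]
      have h0 := Int.emod_nonneg x (show (p : ℤ) ≠ 0 by omega)
      have h1 := Int.emod_lt_of_pos x (show (0 : ℤ) < p by omega)
      have := congrFun he ⟨(x % p).toNat, by omega⟩
      simp only at this
      rwa [Int.toNat_of_nonneg h0] at this
    rcases lt_or_gt_of_ne (fun h => hne (Fin.ext h) : (i : ℕ) ≠ j) with h | h
    · exact ⟨i, j, h, by omega, hfe⟩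
    · exact ⟨j, i, h, by omega, hfe.symm⟩
  obtain ⟨q, hq, rfl⟩ : ∃ q, 0 < q ∧ j = i + q := ⟨j - i, by omega, by omega⟩
  have hstep : ∀ k, f.evolve ξ (i + k + q) = f.evolve ξ (i + k) := by
    intro k
    rw [show i + k + q = i + q + k by ring, evolve_add, ← heq, ← evolve_add]
  have hmul : ∀ n k, f.evolve ξ (i + k + q * n) = f.evolve ξ (i + k) := by
    intro n k
    induction n with
    | zero => rfl
    | succ n ih =>
      rw [show i + k + q * (n + 1) = i + (k + q * n) + q by ring, hstep, ← ih, add_assoc]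
  -- Reducing `t - i` modulo `q` extends the eventual cycle to all times, negative ones included.
  refine ⟨⟨fun x t => f.evolve ξ (i + ((t - i) % q).toNat) x, fun x t => hone _ _,
    ⟨p, by omega, fun x t => evolve_periodic f hper _ x⟩, ⟨q, by omega, fun x t => ?_⟩⟩, ?_, ?_⟩
  · rw [show t + q - i = t - i + q by ring, Int.add_emod_right]
  · exact fun h x t => h _ x
  · intro k hk x
    obtain ⟨d, rfl⟩ : ∃ d, k = i + d := ⟨k - i, by omega⟩
    simp only
    rw [show ((i + d : ℕ) : ℤ) - i = d by push_cast; ring, ← Int.natCast_mod, Int.toNat_natCast,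
      ← hmul (d / q) (d % q), add_assoc, Nat.mod_add_div]

end CARule

/-! ### Uniform rows and conditioning -/

theorem exists_recurrence (d : ℕ → ZMod 2) (p q : ZMod 2) :
    ∃ u : ℕ → ZMod 2, u 0 = p ∧ u 1 = q ∧ ∀ n, u (n + 2) = d n + u n + u (n + 1) := by
  let w : ℕ → ZMod 2 × ZMod 2 := fun n => Nat.rec (p, q) (fun k a => (a.2, d k + a.1 + a.2)) n
  exact ⟨fun n => (w n).1, rfl, rfl, fun n => rfl⟩

/-- A row has a predecessor with arbitrary prescribed values at two adjacent sites. -/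
theorem exists_webStep_eq (d : ℤ → ZMod 2) (y : ℤ) (p q : ZMod 2) :
    ∃ c, webStep c = d ∧ c y = p ∧ c (y + 1) = q := by
  obtain ⟨u, hu0, hu1, hu⟩ := exists_recurrence (fun n => d (y + 1 + n)) p q
  obtain ⟨v, hv0, hv1, hv⟩ := exists_recurrence (fun n => d (y - n)) q p
  let c : ℤ → ZMod 2 := fun z => if y ≤ z then u (z - y).toNat else v (y + 1 - z).toNat
  have hcu : ∀ n : ℕ, c (y + n) = u n := by
    intro n
    simp only [c]
    rw [if_pos (by omega)]; congr 1; omega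
  have hcv : ∀ n : ℕ, c (y + 1 - n) = v n := by
    intro n
    rcases n with _ | _ | n
    · rw [hv0, ← hu1, ← hcu]; simp
    · rw [hv1, ← hu0, ← hcu]; simp
    · simp only [c]
      rw [if_neg (by push_cast; omega)]; congr 1; omega
  have h2 : ∀ a b e : ZMod 2, a + b + (e + a + b) = e := by decide
  have h3 : ∀ a b e : ZMod 2, (e + a + b) + b + a = e := by decide
  refine ⟨c, funext fun z => ?_, by simpa [hu0] using hcu 0, by simpa [hu1] using hcu 1⟩
  simp only [webStep]
  rcases lt_or_ge y z with hz | hz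
  · obtain ⟨n, rfl⟩ : ∃ n : ℕ, z = y + 1 + n := ⟨(z - y - 1).toNat, by omega⟩
    have e0 := hcu n
    have e1 := hcu (n + 1)
    have e2 := hcu (n + 2)
    push_cast at e1 e2
    rw [show y + 1 + (n : ℤ) - 1 = y + n by ring, show y + 1 + (n : ℤ) = y + (n + 1) by ring,
      show y + ((n : ℤ) + 1) + 1 = y + (n + 2) by ring, e0, e1, e2, hu, h2]
    congr 1; ring
  · obtain ⟨n, rfl⟩ : ∃ n : ℕ, z = y - n := ⟨(y - z).toNat, by omega⟩
    have e0 := hcv n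
    have e1 := hcv (n + 1)
    have e2 := hcv (n + 2)
    push_cast at e1 e2
    rw [show y - (n : ℤ) + 1 = y + 1 - n by ring, show y - (n : ℤ) - 1 = y + 1 - (n + 2) by ring,
      show y - (n : ℤ) = y + 1 - (n + 1) by ring, e0, e1, e2, hv, h3]
    congr 1; ring

/-- The proportion of elements of a finite type with a given property. -/
noncomputable def proportion (G : Type) (Q : G → Prop) : ℝ := Nat.card {g // Q g} / Nat.card G

theorem proportion_mono {G : Type} [Finite G] {Q Q' : G → Prop} (h : ∀ g, Q g → Q' g) :
    proportion G Q ≤ proportion G Q' := by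
  unfold proportion
  gcongr
  exact Nat.card_le_card_of_injective (fun g : {g // Q g} => (⟨g.1, h g.1 g.2⟩ : {g // Q' g}))
    fun a b hab => Subtype.ext (congrArg (fun z => z.1) hab)

theorem proportion_or_le {G : Type} [Finite G] (Q Q' : G → Prop) :
    proportion G (fun g => Q g ∨ Q' g) ≤ proportion G Q + proportion G Q' := by
  unfold proportion
  rw [← add_div]
  gcongr
  have := Set.ncard_union_le {g | Q g} {g | Q' g}
  exact_mod_cast this

theorem proportion_le_one {G : Type} [Finite G] (Q : G → Prop) : proportion G Q ≤ 1 := by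
  unfold proportion
  refine div_le_one_of_le₀ ?_ (by positivity)
  exact_mod_cast Nat.card_le_card_of_injective (fun g : {g // Q g} => g.1) Subtype.val_injective

/-- Conditioning on the value of a surjective homomorphism. -/
theorem exists_proportion_eq_ker {G A : Type} [AddCommGroup G] [Finite G] [AddCommGroup A]
    [Finite A] (φ : G →+ A) (hφ : Function.Surjective φ) (a : A) (Q : G → Prop) :
    ∃ g₀ : G, proportion G (fun g => φ g = a ∧ Q g) =
      proportion φ.ker (fun k => Q (g₀ + k)) / Nat.card A := by
  obtain ⟨g₀, rfl⟩ := hφ a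
  refine ⟨g₀, ?_⟩
  have hcard : Nat.card φ.ker * Nat.card A = Nat.card G := by
    rw [← AddSubgroup.card_mul_index φ.ker, AddSubgroup.index_ker,
      AddMonoidHom.range_eq_top.mpr hφ, AddSubgroup.card_top]
  have e : {g // φ g = φ g₀ ∧ Q g} ≃ {k : φ.ker // Q (g₀ + k)} :=
    { toFun := fun g => ⟨⟨g.1 - g₀, by
        rw [AddMonoidHom.mem_ker, map_sub, g.2.1, sub_self]⟩, by simpa using g.2.2⟩
      invFun := fun k => ⟨g₀ + k.1, by
        have := k.1.2
        rw [AddMonoidHom.mem_ker] at this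
        rw [map_add, this, add_zero], k.2⟩
      left_inv := fun g => by simp
      right_inv := fun k => by simp }
  unfold proportion
  rw [Nat.card_congr e, ← hcard, div_div]
  push_cast
  rfl

/-- The family of rows `ρ g`, for `g` uniformly random in the finite group `G`, is uniform on the
interval `[a, b]`. -/
def FreeOn {G : Type} [AddCommGroup G] (ρ : G →+ (ℤ → ZMod 2)) (a b : ℤ) : Prop :=
  ∀ w : ℤ → ZMod 2, ∃ g, ∀ y, a ≤ y → y ≤ b → ρ g y = w y

/-- A random row that is uniform on `[a, b]` lies in `E` with probability at most `q`. -/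
def UnifBound (E : Set (ℤ → ZMod 2)) (a b : ℤ) (q : ℝ) : Prop :=
  ∀ (G : Type) [AddCommGroup G] [Finite G] (ρ : G →+ (ℤ → ZMod 2)) (r : ℤ → ZMod 2),
    FreeOn ρ a b → proportion G (fun g => r + ρ g ∈ E) ≤ q

theorem UnifBound.mono {E E' : Set (ℤ → ZMod 2)} {a b a' b' : ℤ} {q q' : ℝ}
    (h : UnifBound E a b q) (hE : E' ⊆ E) (ha : a' ≤ a) (hb : b ≤ b') (hq : q ≤ q') :
    UnifBound E' a' b' q' := by
  intro G _ _ ρ r hρ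
  refine ((proportion_mono fun g hg => hE hg).trans (h G ρ r fun w => ?_)).trans hq
  obtain ⟨g, hg⟩ := hρ w
  exact ⟨g, fun y h1 h2 => hg y (by omega) (by omega)⟩

theorem UnifBound.union {E E' : Set (ℤ → ZMod 2)} {a b : ℤ} {q q' : ℝ}
    (h : UnifBound E a b q) (h' : UnifBound E' a b q') : UnifBound (E ∪ E') a b (q + q') := by
  intro G _ _ ρ r hρ
  exact (proportion_or_le _ _).trans (add_le_add (h G ρ r hρ) (h' G ρ r hρ))

/-- `webStep` as a homomorphism. -/
def webStepHom : (ℤ → ZMod 2) →+ (ℤ → ZMod 2) where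
  toFun := webStep
  map_zero' := webStep_zero
  map_add' := webStep_add

/-- A condition on a row, together with independent conditions on its next row. -/
theorem UnifBound.cond {A : Type} [AddCommGroup A] [Finite A] {E : Set (ℤ → ZMod 2)} {a b : ℤ}
    {q : ℝ} (h : UnifBound E a b q) (φ : (ℤ → ZMod 2) →+ A)
    (hloc : ∀ c d : ℤ → ZMod 2, (∀ y, a - 1 ≤ y → y ≤ b + 1 → c y = d y) → φ c = φ d)
    (hex : ∀ d v, ∃ c, webStep c = d ∧ φ c = v) (v : A) :
    UnifBound {c | φ c = v ∧ webStep c ∈ E} (a - 1) (b + 1) (q / Nat.card A) := by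
  intro G _ _ ρ r hρ
  have hsurj : Function.Surjective (φ.comp ρ) := by
    intro v
    obtain ⟨c, -, hc⟩ := hex 0 v
    obtain ⟨g, hg⟩ := hρ c
    exact ⟨g, (hloc _ _ hg).trans hc⟩
  obtain ⟨g₀, hg₀⟩ := exists_proportion_eq_ker (φ.comp ρ) hsurj (v - φ r)
    (fun g => webStep (r + ρ g) ∈ E)
  have e1 : proportion G (fun g => r + ρ g ∈ {c | φ c = v ∧ webStep c ∈ E}) =
      proportion G (fun g => φ.comp ρ g = v - φ r ∧ webStep (r + ρ g) ∈ E) := by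
    congr 1
    funext g
    refine propext (and_congr ?_ Iff.rfl)
    rw [map_add, eq_sub_iff_add_eq, add_comm]
    rfl
  rw [e1, hg₀]
  gcongr
  have e2 : ∀ k : (φ.comp ρ).ker, webStep (r + ρ (g₀ + k)) = webStep (r + ρ g₀) +
      (webStepHom.comp (ρ.comp (φ.comp ρ).ker.subtype)) k := by
    intro k
    rw [map_add, ← add_assoc, webStep_add]
    rfl
  simp only [e2]
  -- Conditioning replaces the group by the kernel of `φ.comp ρ` and the offset by a new one. The
  -- next rows are still free: a predecessor of `w` with `φ`-value `0` is realised by an element of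
  -- this kernel.
  refine h _ _ _ fun w => ?_
  obtain ⟨c, hc1, hc2⟩ := hex w 0
  obtain ⟨g, hg⟩ := hρ c
  refine ⟨⟨g, ?_⟩, fun y h1 h2 => ?_⟩
  · rw [AddMonoidHom.mem_ker]
    exact (hloc _ _ hg).trans hc2
  · change webStep (ρ g) y = w y
    rw [← hc1]
    simp only [webStep]
    rw [hg (y - 1) (by omega) (by omega), hg y (by omega) (by omega),
      hg (y + 1) (by omega) (by omega)]

theorem UnifBound.cond_one {E : Set (ℤ → ZMod 2)} {a b : ℤ} {q : ℝ} (h : UnifBound E a b q)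
    {y : ℤ} (ha : a - 1 ≤ y) (hb : y ≤ b + 1) (p : ZMod 2) :
    UnifBound {c | c y = p ∧ webStep c ∈ E} (a - 1) (b + 1) (q / 2) := by
  have := h.cond (Pi.evalAddMonoidHom (fun _ : ℤ => ZMod 2) y) (fun c d hcd => hcd y ha hb)
    (fun d v => by
      obtain ⟨c, h1, h2, -⟩ := exists_webStep_eq d y v 0
      exact ⟨c, h1, h2⟩) p
  simpa using this

theorem UnifBound.cond_two {E : Set (ℤ → ZMod 2)} {a b : ℤ} {q : ℝ} (h : UnifBound E a b q)
    {y z : ℤ} (ha : a - 1 ≤ y) (hz : z = y + 1 ∨ z = y + 2) (hb : z ≤ b + 1) (p p' : ZMod 2) :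
    UnifBound {c | c y = p ∧ c z = p' ∧ webStep c ∈ E} (a - 1) (b + 1) (q / 4) := by
  have := h.cond ((Pi.evalAddMonoidHom (fun _ : ℤ => ZMod 2) y).prod
    (Pi.evalAddMonoidHom (fun _ : ℤ => ZMod 2) z))
    (fun c d hcd => Prod.ext (hcd y ha (by omega)) (hcd z (by omega) hb))
    (fun d v => by
      rcases hz with rfl | rfl
      · obtain ⟨c, h1, h2, h3⟩ := exists_webStep_eq d y v.1 v.2
        exact ⟨c, h1, Prod.ext h2 h3⟩
      -- The value at `y + 1` is chosen so that the equation for the next row at `y + 1` yields the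
      -- wanted value at `y + 2`.
      · obtain ⟨c, h1, h2, h3⟩ := exists_webStep_eq d y v.1 (d (y + 1) + v.1 + v.2)
        refine ⟨c, h1, Prod.ext h2 ?_⟩
        have h4 := congrFun h1 (y + 1)
        simp only [webStep] at h4
        rw [add_sub_cancel_right, h2, h3, show y + 1 + 1 = y + 2 by ring] at h4
        have h5 : ∀ e s t x : ZMod 2, s + (e + s + t) + x = e → x = t := by decide
        exact h5 _ _ _ _ h4) (p, p')
  have e : (Nat.card (ZMod 2 × ZMod 2) : ℝ) = 4 := by norm_num
  rw [e] at this
  refine this.mono (fun c hc => ⟨Prod.ext hc.1 hc.2.1, hc.2.2⟩) le_rfl le_rfl le_rfl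

/-! ### Subcriticality of empty paths -/

/-- An exploration of the successive runs of `0`s below a `0` at `x`.  For `e = ±1`, the site
`x + e` is known to be occupied; for `e = 0`, nothing is known about the neighbours of `x`. -/
def runExploration : ℕ → ℤ → ℤ → Set (ℤ → ZMod 2)
  | 0, e, x => {c | c x = 0 ∧ (e = 0 ∨ c (x + e) = 1)}
  | n + 1, e, x => {c | c x = 0 ∧ (e = 0 ∨ c (x + e) = 1) ∧
      (webStep c ∈ runExploration n 0 x ∨
        (e = 0 ∨ e = 1) ∧ c (x + 1) = 1 ∧ webStep c ∈ runExploration n 1 (x - 1) ∨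
        (e = 0 ∨ e = -1) ∧ c (x - 1) = 1 ∧ webStep c ∈ runExploration n (-1) (x + 1))}

theorem UnifBound.univ (a b : ℤ) : UnifBound Set.univ a b 1 := by
  intro G _ _ ρ r _
  exact proportion_le_one _

/-- The weights `1/2, 1/4, 1/4` form an eigenvector with eigenvalue `3/4`: `1/2 * 1/2 + 2 * (1/4 *
1/4) = 3/8` and `1/4 * 1/2 + 1/4 * 1/4 = 3/16`. -/
theorem runExploration_bound (n : ℕ) : ∀ x : ℤ,
    UnifBound (runExploration n 0 x) (x - 2 * n - 1) (x + 2 * n + 1) (1 / 2 * (3 / 4) ^ n) ∧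
    UnifBound (runExploration n 1 x) (x - 2 * n - 1) (x + 2 * n + 1) (1 / 4 * (3 / 4) ^ n) ∧
    UnifBound (runExploration n (-1) x) (x - 2 * n - 1) (x + 2 * n + 1) (1 / 4 * (3 / 4) ^ n) := by
  induction n with
  | zero =>
    intro x
    have h := UnifBound.univ x x
    refine ⟨?_, ?_, ?_⟩
    · exact (h.cond_one (y := x) (by omega) (by omega) 0).mono (fun c hc => ⟨hc.1, trivial⟩)
        (by simp) (by simp) (by norm_num)
    · exact (h.cond_two (y := x) (z := x + 1) (by omega) (by omega) (by omega) 0 1).mono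
        (fun c hc => ⟨hc.1, hc.2.resolve_left (by norm_num), trivial⟩)
        (by simp) (by simp) (by norm_num)
    · exact (h.cond_two (y := x - 1) (z := x) (by omega) (by omega) (by omega) 1 0).mono
        (fun c hc => ⟨hc.2.resolve_left (by norm_num), hc.1, trivial⟩)
        (by simp) (by simp) (by norm_num)
  | succ n ih =>
    intro x
    obtain ⟨hF, hR, hL⟩ := ih x
    obtain ⟨-, hR', -⟩ := ih (x - 1)
    obtain ⟨-, -, hL'⟩ := ih (x + 1)
    push_cast
    have hq : (3 / 4 : ℝ) ^ (n + 1) = 3 / 4 * (3 / 4) ^ n := by ring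
    rw [hq]
    have bR : UnifBound {c | c x = 0 ∧ c (x + 1) = 1 ∧ webStep c ∈ runExploration n 1 (x - 1)}
        (x - 2 * (n + 1) - 1) (x + 2 * (n + 1) + 1) (1 / 4 * (3 / 4) ^ n / 4) :=
      (hR'.cond_two (y := x) (z := x + 1) (by omega) (by omega) (by omega) 0 1).mono
        (fun c hc => hc) (by omega) (by omega) le_rfl
    have bL : UnifBound {c | c (x - 1) = 1 ∧ c x = 0 ∧ webStep c ∈ runExploration n (-1) (x + 1)}
        (x - 2 * (n + 1) - 1) (x + 2 * (n + 1) + 1) (1 / 4 * (3 / 4) ^ n / 4) :=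
      (hL'.cond_two (y := x - 1) (z := x) (by omega) (by omega) (by omega) 1 0).mono
        (fun c hc => hc) (by omega) (by omega) le_rfl
    refine ⟨?_, ?_, ?_⟩
    · have b0 : UnifBound {c | c x = 0 ∧ webStep c ∈ runExploration n 0 x}
          (x - 2 * (n + 1) - 1) (x + 2 * (n + 1) + 1) (1 / 2 * (3 / 4) ^ n / 2) :=
        (hF.cond_one (y := x) (by omega) (by omega) 0).mono
          (fun c hc => hc) (by omega) (by omega) le_rfl
      refine ((b0.union bR).union bL).mono ?_ le_rfl le_rfl (le_of_eq (by ring))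
      rintro c ⟨h1, -, h2 | ⟨-, h2⟩ | ⟨-, h2⟩⟩
      · exact Or.inl (Or.inl ⟨h1, h2⟩)
      · exact Or.inl (Or.inr ⟨h1, h2⟩)
      · exact Or.inr ⟨h2.1, h1, h2.2⟩
    · have b0 : UnifBound {c | c x = 0 ∧ c (x + 1) = 1 ∧ webStep c ∈ runExploration n 0 x}
          (x - 2 * (n + 1) - 1) (x + 2 * (n + 1) + 1) (1 / 2 * (3 / 4) ^ n / 4) :=
        (hF.cond_two (y := x) (z := x + 1) (by omega) (by omega) (by omega) 0 1).mono
          (fun c hc => hc) (by omega) (by omega) le_rfl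
      refine (b0.union bR).mono ?_ le_rfl le_rfl (le_of_eq (by ring))
      rintro c ⟨h1, he, h2 | ⟨-, h2⟩ | ⟨h2, -⟩⟩
      · exact Or.inl ⟨h1, he.resolve_left (by norm_num), h2⟩
      · exact Or.inr ⟨h1, h2⟩
      · omega
    · have b0 : UnifBound {c | c (x - 1) = 1 ∧ c x = 0 ∧ webStep c ∈ runExploration n 0 x}
          (x - 2 * (n + 1) - 1) (x + 2 * (n + 1) + 1) (1 / 2 * (3 / 4) ^ n / 4) :=
        (hF.cond_two (y := x - 1) (z := x) (by omega) (by omega) (by omega) 1 0).mono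
          (fun c hc => hc) (by omega) (by omega) le_rfl
      refine (b0.union bL).mono ?_ le_rfl le_rfl (le_of_eq (by ring))
      rintro c ⟨h1, he, h2 | ⟨h2, -⟩ | ⟨-, h2⟩⟩
      · exact Or.inl ⟨he.resolve_left (by norm_num), h1, h2⟩
      · omega
      · exact Or.inr ⟨h2.1, h1, h2.2⟩

/-- The row `c` vanishes between `x` and `y`. -/
def SameRun (c : ℤ → ZMod 2) (x y : ℤ) : Prop := ∀ w, min x y ≤ w → w ≤ max x y → c w = 0

theorem Survives.apply_eq_zero {S : (ℤ → ZMod 2) → ℤ → ℤ → Prop} {n : ℕ} {c : ℤ → ZMod 2} {x : ℤ}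
    (h : Survives S n c x) : c x = 0 := by
  cases n with
  | zero => exact h
  | succ n => exact h.1

theorem SameRun.trans {c : ℤ → ZMod 2} {x y z : ℤ} (h : SameRun c x y) (h' : SameRun c y z) :
    SameRun c x z := by
  intro w h1 h2
  by_cases hw : min x y ≤ w ∧ w ≤ max x y
  · exact h w hw.1 hw.2
  · exact h' w (by omega) (by omega)

/-- A wide step can be replaced by a vertical step, preceded or followed by a move within a run. -/
theorem exists_sameRun_of_wideStep {c : ℤ → ZMod 2} {x y : ℤ} (hx : c x = 0)
    (hy : webStep c y = 0) (h : wideStep c x y) :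
    ∃ z, SameRun c x z ∧ webStep c z = 0 ∧ SameRun (webStep c) z y := by
  have hself : ∀ (d : ℤ → ZMod 2) u, d u = 0 → SameRun d u u := by
    intro d u hu w h1 h2
    obtain rfl : w = u := by omega
    exact hu
  have hpair : ∀ (d : ℤ → ZMod 2) u v, v = u - 1 ∨ v = u + 1 → d u = 0 → d v = 0 →
      SameRun d u v := by
    intro d u v huv hu hv w h1 h2
    obtain rfl | rfl : w = u ∨ w = v := by omega
    · exact hu
    · exact hv
  rcases h with rfl | ⟨hxy, hne⟩
  · exact ⟨y, hself _ _ hx, hy, hself _ _ hy⟩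
  · by_cases hcy : c y = 0
    · exact ⟨y, hpair _ _ _ hxy hx hcy, hy, hself _ _ hy⟩
    · have hcx : webStep c x = 0 := by
        rw [← zmod_two_ne_one]
        exact fun h => hne ⟨zmod_two_ne_zero.mp hcy, h⟩
      exact ⟨x, hself _ _ hx, hcx, hpair _ _ _ hxy hcx hy⟩

/-- Below a run of `0`s there is at most one run, and it can be located from any site of the
original run. -/
theorem SameRun.exists_step {c : ℤ → ZMod 2} {z y : ℤ} (h : SameRun c z y)
    (hy : webStep c y = 0) :
    webStep c z = 0 ∧ SameRun (webStep c) z y ∨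
      c (z + 1) = 1 ∧ c (z - 1) = 0 ∧ webStep c z = 1 ∧ SameRun (webStep c) (z - 1) y ∨
      c (z - 1) = 1 ∧ c (z + 1) = 0 ∧ webStep c z = 1 ∧ SameRun (webStep c) (z + 1) y := by
  have hz : c z = 0 := h z (by omega) (by omega)
  have hcy : c y = 0 := h y (by omega) (by omega)
  rcases lt_trichotomy z y with hlt | rfl | hlt
  · have h1 : c (z + 1) = 0 := h _ (by omega) (by omega)
    -- As `y` has a `0` to its left in the run and a `0` below it, it is not the right end of the
    -- run.
    have h2 : c (y + 1) = 0 := by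
      simp only [webStep] at hy
      rw [h (y - 1) (by omega) (by omega), hcy] at hy
      simpa using hy
    have hrun : ∀ w, z + 1 ≤ w → w ≤ y → webStep c w = 0 := by
      intro w w1 w2
      simp only [webStep]
      rw [h (w - 1) (by omega) (by omega), h w (by omega) (by omega)]
      rcases eq_or_lt_of_le w2 with rfl | w3
      · rw [h2]; rfl
      · rw [h (w + 1) (by omega) (by omega)]; rfl
    have hzs : webStep c z = c (z - 1) := by simp [webStep, hz, h1]
    rcases zmod_two_eq_zero_or_one (c (z - 1)) with h3 | h3
    · refine Or.inl ⟨hzs.trans h3, fun w w1 w2 => ?_⟩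
      rcases eq_or_ne w z with rfl | hw
      · exact hzs.trans h3
      · exact hrun w (by omega) (by omega)
    · exact Or.inr (Or.inr ⟨h3, h1, hzs.trans h3, fun w w1 w2 => hrun w (by omega) (by omega)⟩)
  · refine Or.inl ⟨hy, fun w w1 w2 => ?_⟩
    obtain rfl : w = z := by omega
    exact hy
  · have h1 : c (z - 1) = 0 := h _ (by omega) (by omega)
    have h2 : c (y - 1) = 0 := by
      simp only [webStep] at hy
      rw [h (y + 1) (by omega) (by omega), hcy] at hy
      simpa using hy
    have hrun : ∀ w, y ≤ w → w ≤ z - 1 → webStep c w = 0 := by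
      intro w w1 w2
      simp only [webStep]
      rw [h (w + 1) (by omega) (by omega), h w (by omega) (by omega)]
      rcases eq_or_lt_of_le w1 with rfl | w3
      · rw [h2]; rfl
      · rw [h (w - 1) (by omega) (by omega)]; rfl
    have hzs : webStep c z = c (z + 1) := by simp [webStep, hz, h1]
    rcases zmod_two_eq_zero_or_one (c (z + 1)) with h3 | h3
    · refine Or.inl ⟨hzs.trans h3, fun w w1 w2 => ?_⟩
      rcases eq_or_ne w z with rfl | hw
      · exact hzs.trans h3
      · exact hrun w (by omega) (by omega)
    · exact Or.inr (Or.inl ⟨h3, h1, hzs.trans h3, fun w w1 w2 => hrun w (by omega) (by omega)⟩)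

/-- A wide path stays in the successive runs, so it suffices to follow one site `z` of its current
run. When `z` has a `1` below it, the followed site moves away from the occupied neighbour, and that
new `1` becomes the recorded neighbour. -/
theorem Survives.mem_runExploration {n : ℕ} {c : ℤ → ZMod 2} {y : ℤ}
    (h : Survives wideStep n c y) {z e : ℤ} (he : e = 0 ∨ e = 1 ∨ e = -1)
    (hez : e = 0 ∨ c (z + e) = 1) (hrun : SameRun c z y) : c ∈ runExploration n e z := by
  have hz : c z = 0 := hrun z (by omega) (by omega)
  induction n generalizing c y z e with
  | zero => exact ⟨hz, hez⟩
  | succ n ih =>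
    obtain ⟨hy, y', hstep, h'⟩ := h
    obtain ⟨y'', r1, r2, r3⟩ := exists_sameRun_of_wideStep hy h'.apply_eq_zero hstep
    refine ⟨hz, hez, ?_⟩
    rcases (hrun.trans r1).exists_step r2 with ⟨s1, s2⟩ | ⟨s1, s2, s3, s4⟩ | ⟨s1, s2, s3, s4⟩
    · exact Or.inl (ih h' (Or.inl rfl) (Or.inl rfl) (s2.trans r3) s1)
    · refine Or.inr (Or.inl ⟨?_, s1, ih h' (Or.inr (Or.inl rfl)) (Or.inr ?_) (s4.trans r3) ?_⟩)
      · rcases he with rfl | rfl | rfl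
        · exact Or.inl rfl
        · exact Or.inr rfl
        · exfalso
          rw [← sub_eq_add_neg, s2] at hez
          revert hez; decide
      · rwa [sub_add_cancel]
      · exact s4 _ (by omega) (by omega)
    · refine Or.inr (Or.inr ⟨?_, s1, ih h' (Or.inr (Or.inr rfl)) (Or.inr ?_) (s4.trans r3) ?_⟩)
      · rcases he with rfl | rfl | rfl
        · exact Or.inl rfl
        · exfalso
          rw [s2] at hez
          revert hez; decide
        · exact Or.inr rfl
      · rwa [← sub_eq_add_neg, add_sub_cancel_right]
      · exact s4 _ (by omega) (by omega)

/-- An exploration of the diagonal empty paths from `x`, in blocks of two steps, in which a step to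
the right followed by one to the left is used only if the opposite order is impossible. -/
def diagonalExploration : ℕ → ℤ → Set (ℤ → ZMod 2)
  | 0, _ => Set.univ
  | k + 1, x => {c | c x = 0 ∧ webStep c ∈
      {d | d (x - 1) = 0 ∧ webStep d ∈ diagonalExploration k (x - 2)} ∪
      {d | d (x + 1) = 0 ∧ webStep d ∈ diagonalExploration k (x + 2)} ∪
      {d | d (x - 1) = 0 ∧ webStep d ∈ diagonalExploration k x} ∪
      {d | d (x - 1) = 1 ∧ d (x + 1) = 0 ∧ webStep d ∈ diagonalExploration k x}}

/-- One block costs `1/2 * (1/2 + 1/2 + 1/2 + 1/4) = 7/8`. Counting both returns to `x` separately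
would give `1`; making the second exclusive of the first gains the strict inequality. -/
theorem diagonalExploration_bound (k : ℕ) : ∀ x : ℤ,
    UnifBound (diagonalExploration k x) (x - 4 * k) (x + 4 * k) ((7 / 8) ^ k) := by
  induction k with
  | zero => exact fun x => (UnifBound.univ _ _).mono (Set.subset_univ _) le_rfl le_rfl (by simp)
  | succ k ih =>
    intro x
    push_cast
    have b1 := ((ih (x - 2)).cond_one (y := x - 1) (by omega) (by omega) 0).mono
      (a' := x - 4 * k - 3) (b' := x + 4 * k + 3) subset_rfl (by omega) (by omega) le_rfl
    have b2 := ((ih (x + 2)).cond_one (y := x + 1) (by omega) (by omega) 0).mono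
      (a' := x - 4 * k - 3) (b' := x + 4 * k + 3) subset_rfl (by omega) (by omega) le_rfl
    have b3 := ((ih x).cond_one (y := x - 1) (by omega) (by omega) 0).mono
      (a' := x - 4 * k - 3) (b' := x + 4 * k + 3) subset_rfl (by omega) (by omega) le_rfl
    have b4 := ((ih x).cond_two (y := x - 1) (z := x + 1) (by omega) (by omega) (by omega) 1 0).mono
      (a' := x - 4 * k - 3) (b' := x + 4 * k + 3) subset_rfl (by omega) (by omega) le_rfl
    refine ((((b1.union b2).union b3).union b4).cond_one (y := x) (by omega) (by omega) 0).mono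
      subset_rfl (by omega) (by omega) (le_of_eq (by ring))

theorem Survives.mem_diagonalExploration {k : ℕ} {c : ℤ → ZMod 2} {x : ℤ}
    (h : Survives diagonalStep (2 * k) c x) : c ∈ diagonalExploration k x := by
  induction k generalizing c x with
  | zero => exact trivial
  | succ k ih =>
    obtain ⟨h0, y, hy, h1, z, hz, h2⟩ : Survives diagonalStep (2 * k + 1 + 1) c x := h
    refine ⟨h0, ?_⟩
    have h3 := ih h2
    rcases hy with rfl | rfl <;> rcases hz with rfl | rfl
    · rw [show x - 1 - 1 = x - 2 by ring] at h3
      exact Or.inl (Or.inl (Or.inl ⟨h1, h3⟩))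
    · rw [sub_add_cancel] at h3
      exact Or.inl (Or.inr ⟨h1, h3⟩)
    · rw [add_sub_cancel_right] at h3
      rcases zmod_two_eq_zero_or_one (webStep c (x - 1)) with h4 | h4
      · exact Or.inl (Or.inr ⟨h4, h3⟩)
      · exact Or.inr ⟨h4, h1, h3⟩
    · rw [show x + 1 + 1 = x + 2 by ring] at h3
      exact Or.inl (Or.inl (Or.inr ⟨h1, h3⟩))

/-- Subcriticality of the percolation defined by a step relation. -/
def Subcritical (S : (ℤ → ZMod 2) → ℤ → ℤ → Prop) : Prop :=
  ∀ (k : ℕ) (x : ℤ), UnifBound {c | Survives S (2 * k) c x} (x - 4 * k - 1) (x + 4 * k + 1)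
    ((7 / 8) ^ k)

theorem diagonalStep_subcritical : Subcritical diagonalStep := fun k x =>
  (diagonalExploration_bound k x).mono (fun _ hc => hc.mem_diagonalExploration) (by omega)
    (by omega) le_rfl

theorem wideStep_subcritical : Subcritical wideStep := by
  intro k x
  refine (runExploration_bound (2 * k) x).1.mono (fun c hc => ?_) (by push_cast; omega)
    (by push_cast; omega) ?_
  · refine Survives.mem_runExploration hc (Or.inl rfl) (Or.inl rfl) fun w h1 h2 => ?_
    obtain rfl : w = x := by omega
    exact Survives.apply_eq_zero hc
  · rw [pow_mul]
    have h1 : ((3 / 4 : ℝ) ^ 2) ^ k ≤ (7 / 8) ^ k := by gcongr; norm_num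
    have h2 : (0 : ℝ) ≤ ((3 / 4 : ℝ) ^ 2) ^ k := by positivity
    linarith

/-! ### Pattern rows of random seeds -/

/-- The row that precedes a void of `oneOrThreeSingle` by `2 ^ m` steps, superposed over the `1`s of
a seed. -/
def patternRow (m : ℕ) {L : ℕ} : (Fin (L + 1) → ZMod 2) →+ (ℤ → ZMod 2) where
  toFun v x := ∑ i, v i * sparsePattern m (x - (i : ℕ))
  map_zero' := by funext x; simp
  map_add' v w := by funext x; simp [add_mul, Finset.sum_add_distrib]

theorem patternRow_apply (m : ℕ) {L : ℕ} (v : Fin (L + 1) → ZMod 2) (x : ℤ) :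
    patternRow m v x = ∑ i, v i * sparsePattern m (x - (i : ℕ)) := rfl

theorem patternRow_sum (m : ℕ) {L : ℕ} (v : Fin (L + 1) → ZMod 2) (x : ℤ) :
    patternRow m v (x - 2 ^ m) + patternRow m v x + patternRow m v (x + 2 ^ m) = 0 := by
  simp only [patternRow_apply, ← Finset.sum_add_distrib, ← mul_add]
  refine Finset.sum_eq_zero fun i _ => ?_
  rw [show x - 2 ^ m - (i : ℕ) = x - (i : ℕ) - 2 ^ m by ring,
    show x + 2 ^ m - (i : ℕ) = x - (i : ℕ) + 2 ^ m by ring, sparsePattern_sum, mul_zero]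

theorem periodic_of_sum_eq_zero {c : ℤ → ZMod 2} {b : ℤ}
    (h : ∀ x, c (x - b) + c x + c (x + b) = 0) (x : ℤ) : c (x + 3 * b) = c x := by
  have h1 := h (x + b)
  have h2 := h (x + b + b)
  rw [add_sub_cancel_right] at h1 h2
  rw [show x + 3 * b = x + b + b + b by ring]
  have h3 : ∀ p q r s : ZMod 2, p + q + r = 0 → q + r + s = 0 → s = p := by decide
  exact h3 _ _ _ _ h1 h2

theorem eq_zero_of_sum_eq_zero {c : ℤ → ZMod 2} {b : ℕ} (hb : 0 < b)
    (h : ∀ x, c (x - b) + c x + c (x + b) = 0) {a : ℤ}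
    (ha : ∀ j : ℕ, j < 2 * b → c (a + j) = 0) (x : ℤ) : c x = 0 := by
  have up : ∀ n : ℕ, c (a + n) = 0 := by
    intro n
    induction n using Nat.strong_induction_on with
    | _ n ih =>
      rcases lt_or_ge n (2 * b) with hn | hn
      · exact ha n hn
      · have h1 := h (a + n - b)
        have e1 := ih (n - b) (by omega)
        have e2 := ih (n - 2 * b) (by omega)
        rw [show a + (n : ℤ) - b - b = a + (n - 2 * b : ℕ) by omega,
          show a + (n : ℤ) - b + b = a + n by ring,
          show a + (n : ℤ) - b = a + (n - b : ℕ) by omega, e1, e2] at h1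
        simpa using h1
  have down : ∀ n : ℕ, c (a + (2 * b : ℕ) - 1 - n) = 0 := by
    intro n
    induction n using Nat.strong_induction_on with
    | _ n ih =>
      rcases lt_or_ge n (2 * b) with hn | hn
      · have := ha (2 * b - 1 - n) (by omega)
        rwa [show a + ((2 * b - 1 - n : ℕ) : ℤ) = a + (2 * b : ℕ) - 1 - n by omega] at this
      · have h1 := h (a + (2 * b : ℕ) - 1 - n + b)
        have e1 := ih (n - b) (by omega)
        have e2 := ih (n - 2 * b) (by omega)
        rw [show a + ((2 * b : ℕ) : ℤ) - 1 - n + b + b = a + (2 * b : ℕ) - 1 - (n - 2 * b : ℕ) by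
            omega, show a + ((2 * b : ℕ) : ℤ) - 1 - n + b - b = a + (2 * b : ℕ) - 1 - n by ring,
          show a + ((2 * b : ℕ) : ℤ) - 1 - n + b = a + (2 * b : ℕ) - 1 - (n - b : ℕ) by omega,
          e1, e2] at h1
        simpa using h1
  rcases le_total a x with hx | hx
  · have := up (x - a).toNat
    rwa [show a + ((x - a).toNat : ℤ) = x by omega] at this
  · have := down (a + (2 * b : ℕ) - 1 - x).toNat
    rwa [show a + ((2 * b : ℕ) : ℤ) - 1 - ((a + (2 * b : ℕ) - 1 - x).toNat : ℤ) = x by omega]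
      at this

theorem sparsePattern_of_abs_lt {m : ℕ} {z : ℤ} (h1 : -(2 * 2 ^ m) < z) (h2 : z < 2 * 2 ^ m) :
    sparsePattern m z = if z = 2 ^ m ∨ z = -2 ^ m then 1 else 0 := by
  have hpos : (0 : ℤ) < 2 ^ m := by positivity
  unfold sparsePattern
  by_cases hd : (2 : ℤ) ^ m ∣ z
  · obtain ⟨y, rfl⟩ := hd
    have h3 : -2 < y := by nlinarith
    have h4 : y < 2 := by nlinarith
    rw [if_pos (dvd_mul_right _ _), Int.mul_ediv_cancel_left _ hpos.ne']
    obtain rfl | rfl | rfl : y = -1 ∨ y = 0 ∨ y = 1 := by omega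
    · rw [if_pos (Or.inr (by ring))]; rfl
    · rw [if_neg (by omega)]; rfl
    · rw [if_pos (Or.inl (by ring))]; rfl
  · rw [if_neg hd, if_neg]
    rintro (rfl | rfl)
    · exact hd (dvd_refl _)
    · exact hd (dvd_neg.mpr (dvd_refl _))

/-- At differences below `2 * 2 ^ m` in size the sparse pattern is nonzero only at `±2 ^ m`. For a
seed supported on `[0, 2 * 2 ^ m)`, the pattern row on that window is thus the seed with its two
halves exchanged. -/
theorem patternRow_apply_nat {m L : ℕ} {v : Fin (L + 1) → ZMod 2}
    (hv : ∀ i : Fin (L + 1), 2 * 2 ^ m ≤ (i : ℕ) → v i = 0) {j k : ℕ}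
    (hjk : j = k + 2 ^ m ∨ k = j + 2 ^ m)
    (hj : j < 2 * 2 ^ m) (hk : k < 2 * 2 ^ m) (hL : k < L + 1) :
    patternRow m v j = v ⟨k, hL⟩ := by
  rw [patternRow_apply, Finset.sum_eq_single (⟨k, hL⟩ : Fin (L + 1))]
  · rw [sparsePattern_of_abs_lt (by push_cast; zify at hj hk; omega)
      (by push_cast; zify at hj hk; omega), if_pos, mul_one]
    rcases hjk with rfl | rfl
    · left; push_cast; ring
    · right; push_cast; ring
  · intro i _ hi
    rcases lt_or_ge (i : ℕ) (2 * 2 ^ m) with h | h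
    · rw [sparsePattern_of_abs_lt (by zify at hj h; omega) (by zify at hj h; omega), if_neg,
        mul_zero]
      intro hcon
      have hne : (i : ℕ) ≠ k := fun h => hi (Fin.ext h)
      zify at hjk hj hk h hne
      omega
    · rw [hv i h, zero_mul]
  · intro h; exact absurd (Finset.mem_univ _) h

/-- For seeds on an interval of length at least `2 * 2 ^ m`, the pattern row is uniform on every
interval of length `2 * 2 ^ m`. -/
theorem patternRow_freeOn {m L : ℕ} (hL : 2 * 2 ^ m ≤ L + 1) (a : ℤ) :
    FreeOn (patternRow m (L := L)) a (a + 2 * 2 ^ m - 1) := by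
  let ext : (Fin (2 * 2 ^ m) → ZMod 2) → (Fin (L + 1) → ZMod 2) :=
    fun w i => if h : (i : ℕ) < 2 * 2 ^ m then w ⟨i, h⟩ else 0
  have ext_sub : ∀ w w', ext (w - w') = ext w - ext w' := by
    intro w w'
    funext i
    simp only [ext, Pi.sub_apply]
    split_ifs <;> simp
  let F : (Fin (2 * 2 ^ m) → ZMod 2) → (Fin (2 * 2 ^ m) → ZMod 2) :=
    fun w j => patternRow m (ext w) (a + (j : ℕ))
  -- A pattern row vanishing on a window of length `2 * 2 ^ m` vanishes everywhere by its
  -- recurrence, and then the seed bits, read off on `[0, 2 * 2 ^ m)`, are `0`. Injectivity between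
  -- finite sets of equal size gives surjectivity.
  have hinj : Function.Injective F := by
    intro w w' hww
    have hz : ∀ x, patternRow m (ext (w - w')) x = 0 := by
      refine eq_zero_of_sum_eq_zero (b := 2 ^ m) (by positivity) (a := a) (fun x => ?_)
        fun j hj => ?_
      · push_cast; exact patternRow_sum _ _ _
      · rw [ext_sub, map_sub, Pi.sub_apply, sub_eq_zero]
        exact congrFun hww ⟨j, hj⟩
    have hv : ∀ i : Fin (L + 1), 2 * 2 ^ m ≤ (i : ℕ) → ext (w - w') i = 0 := by
      intro i hi
      simp only [ext]
      rw [dif_neg (by omega)]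
    rw [← sub_eq_zero]
    funext k
    have hk := k.2
    have e : (w - w') k = ext (w - w') ⟨k, by omega⟩ := by
      simp only [ext]
      rw [dif_pos hk]
    rw [e]
    rcases lt_or_ge (k : ℕ) (2 ^ m) with h | h
    · rw [← patternRow_apply_nat hv (j := k + 2 ^ m) (Or.inl rfl) (by omega) hk (by omega)]
      exact hz _
    · rw [← patternRow_apply_nat hv (j := k - 2 ^ m) (Or.inr (by omega)) (by omega) hk (by omega)]
      exact hz _
  have hsurj := Finite.surjective_of_injective hinj
  intro w
  obtain ⟨g, hg⟩ := hsurj fun j => w (a + (j : ℕ))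
  refine ⟨ext g, fun y h1 h2 => ?_⟩
  have hlt : (y - a).toNat < 2 * 2 ^ m := by zify; omega
  have := congrFun hg ⟨(y - a).toNat, hlt⟩
  simp only [F] at this
  rwa [show a + ((y - a).toNat : ℤ) = y by omega] at this

/-- A binary seed as a vector over the integers modulo `2`. -/
def BinarySeed.vec {L : ℕ} (s : BinarySeed L) : Fin (L + 1) → ZMod 2 :=
  fun i => if s i = true then 1 else 0

/-- `BinarySeed.vec` as an equivalence. -/
def BinarySeed.vecEquiv (L : ℕ) : BinarySeed L ≃ (Fin (L + 1) → ZMod 2) where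
  toFun := BinarySeed.vec
  invFun v := fun i => decide (v i = 1)
  left_inv s := by
    funext i
    cases h : s i <;> simp [BinarySeed.vec, h]
  right_inv v := by
    funext i
    rcases zmod_two_eq_zero_or_one (v i) with h | h <;> simp [BinarySeed.vec, h]

theorem proportion_equiv {G G' : Type} (e : G ≃ G') (Q : G' → Prop) :
    proportion G (fun g => Q (e g)) = proportion G' Q := by
  unfold proportion
  rw [Nat.card_congr e, Nat.card_congr (e.subtypeEquiv (fun _ => Iff.rfl))]

theorem seedLaw_eq_proportion (L : ℕ) (Q : BinarySeed L → Prop) :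
    seedLaw L {s | Q s} = ENNReal.ofReal (proportion (BinarySeed L) Q) := by
  classical
  rw [seedLaw, PMF.toMeasure_uniformOfFintype_apply _ (Set.toFinite _).measurableSet, proportion,
    ENNReal.ofReal_div_of_pos (by exact_mod_cast Nat.card_pos), ENNReal.ofReal_natCast,
    ENNReal.ofReal_natCast,
    Nat.card_eq_fintype_card, Nat.card_eq_fintype_card]
  rfl

theorem proportion_exists_le {G ι : Type} [Finite G] (I : Finset ι) (Q : ι → G → Prop) {q : ℝ}
    (h : ∀ i ∈ I, proportion G (Q i) ≤ q) :
    proportion G (fun g => ∃ i ∈ I, Q i g) ≤ I.card * q := by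
  classical
  induction I using Finset.induction_on with
  | empty => simp [proportion]
  | insert i I hi ih =>
    simp only [Finset.exists_mem_insert]
    rw [Finset.card_insert_of_notMem hi]
    push_cast
    have h1 := proportion_or_le (Q i) (fun g => ∃ j ∈ I, Q j g)
    have h2 := ih fun j hj => h j (Finset.mem_insert_of_mem hj)
    have h3 := h i (Finset.mem_insert_self _ _)
    linarith

/-- No empty path crosses the rows `0, …, 2 ^ m` of the evolution of the pattern row. -/
def Blocked (S : (ℤ → ZMod 2) → ℤ → ℤ → Prop) (m : ℕ) {L : ℕ} (s : BinarySeed L) : Prop :=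
  ∀ x, ¬ Survives S (2 ^ m) (patternRow m s.vec) x

/-- Union bound over the `3 * 2 ^ m = 24 * 2 ^ n` starting points in one period. Only the first `2 *
2 ^ n` steps are used, so that the sites explored fit in a window of length `2 * 2 ^ m`, where the
row is uniform. -/
theorem proportion_not_blocked_le {S : (ℤ → ZMod 2) → ℤ → ℤ → Prop} (hS : ShiftInvariant S)
    (hsub : Subcritical S) {n L : ℕ} (hL : 2 * 2 ^ (n + 3) ≤ L + 1) :
    proportion (BinarySeed L) (fun s => ¬ Blocked S (n + 3) s) ≤
      24 * ((2 ^ n : ℕ) * (7 / 8) ^ (2 ^ n)) := by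
  set m := n + 3 with hm
  have hpow : 2 ^ m = 8 * 2 ^ n := by rw [hm]; ring
  have hpowz : (2 : ℤ) ^ m = 8 * 2 ^ n := by rw [hm]; ring
  have hone : (1 : ℤ) ≤ 2 ^ n := one_le_pow₀ (by norm_num)
  have h1 : ∀ x ∈ Finset.range (3 * 2 ^ m), proportion (BinarySeed L)
      (fun s => Survives S (2 * 2 ^ n) (patternRow m s.vec) (x : ℤ)) ≤ (7 / 8) ^ (2 ^ n) := by
    intro x _
    refine le_of_eq_of_le (proportion_equiv (BinarySeed.vecEquiv L)
      (fun v => Survives S (2 * 2 ^ n) (patternRow m v) (x : ℤ))) ?_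
    have h2 := (hsub (2 ^ n) x).mono (a' := x - 4 * 2 ^ n - 1)
      (b' := x - 4 * 2 ^ n - 1 + 2 * 2 ^ m - 1) subset_rfl (by push_cast; omega)
      (by push_cast; omega) le_rfl
    have h3 := h2 _ (patternRow m) 0 (patternRow_freeOn hL _)
    simp only [zero_add] at h3
    exact h3
  have h2 := proportion_exists_le _ _ h1
  refine (proportion_mono fun s hs => ?_).trans (h2.trans (le_of_eq ?_))
  · simp only [Blocked, not_forall, not_not] at hs
    obtain ⟨x, hx⟩ := hs
    have hper : Function.Periodic (patternRow m s.vec) (3 * 2 ^ m) :=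
      periodic_of_sum_eq_zero (patternRow_sum m s.vec)
    set u : ℤ := -(x / (3 * 2 ^ m)) * (3 * 2 ^ m) with hu
    have hshift : (fun z => patternRow m s.vec (z + u)) = patternRow m s.vec := by
      funext z
      have := hper.int_mul (-(x / (3 * 2 ^ m))) z
      push_cast at this
      exact this
    have hx' : Survives S (2 ^ m) (patternRow m s.vec) (x + u) := by
      refine hS.survives ?_
      rwa [hshift]
    have hxu : x + u = x % (3 * 2 ^ m) := by rw [Int.emod_def, hu]; ring
    have g0 := Int.emod_nonneg x (show (3 * 2 ^ m : ℤ) ≠ 0 by omega)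
    have g1 := Int.emod_lt_of_pos x (show (0 : ℤ) < 3 * 2 ^ m by omega)
    refine ⟨(x % (3 * 2 ^ m)).toNat, ?_, ?_⟩
    · rw [Finset.mem_range]; zify; omega
    · rw [Int.toNat_of_nonneg g0, ← hxu]
      exact hx'.mono (by omega)
  · rw [Finset.card_range, hpow]; push_cast; ring

/-- A nonempty fibre of a homomorphism is a coset of the kernel, of proportion one over the size of
the range. -/
theorem inv_card_le_proportion {G A : Type} [AddCommGroup G] [Finite G] [AddCommGroup A] [Finite A]
    (φ : G →+ A) (g₀ : G) : 1 / (Nat.card A : ℝ) ≤ proportion G (fun g => φ g = φ g₀) := by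
  obtain ⟨g₁, h⟩ := exists_proportion_eq_ker φ.rangeRestrict φ.rangeRestrict_surjective
    (φ.rangeRestrict g₀) (fun _ => True)
  have h1 : proportion φ.rangeRestrict.ker (fun _ => True) = 1 := by
    unfold proportion
    rw [Nat.card_congr (Equiv.subtypeUnivEquiv fun _ => trivial), div_self]
    exact_mod_cast Nat.card_pos.ne'
  rw [h1] at h
  have h2 : (fun g => φ g = φ g₀) = fun g => φ.rangeRestrict g = φ.rangeRestrict g₀ ∧ True := by
    funext g
    simp [← Subtype.coe_inj]
  rw [h2, h]
  gcongr
  · exact_mod_cast Nat.card_pos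
  · exact Nat.card_le_card_of_injective _ (Subtype.val_injective (p := fun a => a ∈ φ.range))

/-- Extension of a seed by `0`s. -/
def BinarySeed.pad {L : ℕ} (s : BinarySeed L) (L' : ℕ) : BinarySeed L' :=
  fun i => if h : (i : ℕ) < L + 1 then s ⟨i, h⟩ else false

theorem patternRow_pad (m : ℕ) {L L' : ℕ} (h : L ≤ L') (s : BinarySeed L) :
    patternRow m (s.pad L').vec = patternRow m s.vec := by
  funext x
  rw [patternRow_apply, patternRow_apply, Finset.sum_fin_eq_sum_range,
    Finset.sum_fin_eq_sum_range]
  symm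
  refine (Finset.sum_subset_zero_on_sdiff (Finset.range_mono (by omega)) ?_ ?_)
  · intro i hi
    simp only [Finset.mem_sdiff, Finset.mem_range] at hi
    rw [dif_pos hi.1, BinarySeed.vec, BinarySeed.pad, dif_neg hi.2]
    simp
  · intro i hi
    rw [Finset.mem_range] at hi
    rw [dif_pos hi, dif_pos (by omega), BinarySeed.vec, BinarySeed.vec, BinarySeed.pad, dif_pos hi]

/-- Finitely many pattern rows agree with given ones with probability bounded away from `0`. -/
theorem exists_le_proportion_patternRow_eq (M : ℕ) {L₀ : ℕ} (s₀ : BinarySeed L₀) :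
    ∃ δ : ℝ, 0 < δ ∧ ∀ L, L₀ ≤ L → δ ≤ proportion (BinarySeed L)
      (fun s => ∀ m ≤ M, patternRow m s.vec = patternRow m s₀.vec) := by
  -- This group does not depend on `L`, and its windows contain a full period of each row of level
  -- at most `M`.
  let A : Type := Fin (M + 1) → Fin (3 * 2 ^ M) → ZMod 2
  refine ⟨1 / (Nat.card A : ℝ), ?_, fun L hL => ?_⟩
  · have : 0 < Nat.card A := Nat.card_pos
    positivity
  · let φ : (Fin (L + 1) → ZMod 2) →+ A :=
      { toFun := fun v m x => patternRow m v (x : ℕ)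
        map_zero' := by
          funext m x
          change patternRow m 0 (x : ℕ) = 0
          rw [map_zero]; rfl
        map_add' := fun v w => by
          funext m x
          change patternRow m (v + w) (x : ℕ) = _
          rw [map_add]; rfl }
    refine (inv_card_le_proportion φ (s₀.pad L).vec).trans ?_
    rw [← proportion_equiv (BinarySeed.vecEquiv L)]
    refine proportion_mono fun s hs m hm => ?_
    rw [← patternRow_pad m hL s₀]
    funext x
    have hper : ∀ t : BinarySeed L, patternRow m t.vec x =
        patternRow m t.vec (x % (3 * 2 ^ m)) := by
      intro t
      have hper : Function.Periodic (patternRow m t.vec) (3 * 2 ^ m) :=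
        periodic_of_sum_eq_zero (patternRow_sum m t.vec)
      have := hper.int_mul (-(x / (3 * 2 ^ m))) x
      have e : x + (-(x / (3 * 2 ^ m)) : ℤ) * (3 * 2 ^ m) = x % (3 * 2 ^ m) := by
        rw [Int.emod_def]; ring
      rw [← e]
      exact this.symm
    have hpos : (0 : ℤ) < 3 * 2 ^ m := by positivity
    have g0 := Int.emod_nonneg x hpos.ne'
    have g1 := Int.emod_lt_of_pos x hpos
    have hle : (2 : ℤ) ^ m ≤ 2 ^ M := pow_le_pow_right₀ (by norm_num) hm
    have := congrFun (congrFun hs ⟨m, by omega⟩) ⟨(x % (3 * 2 ^ m)).toNat, by zify; omega⟩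
    rw [hper, hper]
    change patternRow m _ (((x % (3 * 2 ^ m)).toNat : ℕ) : ℤ) =
      patternRow m _ (((x % (3 * 2 ^ m)).toNat : ℕ) : ℤ) at this
    rwa [Int.toNat_of_nonneg g0] at this

/-! ### Blocked seeds are replicators; conclusion -/

/-- The ether that vanishes identically. -/
def Ether.zero : Ether where
  val _ _ := 0
  ne_one _ _ := by decide
  periodic_space := ⟨1, one_pos, fun _ _ => rfl⟩
  periodic_time := ⟨1, one_pos, fun _ _ => rfl⟩

/-- The translate of an ether. -/
def Ether.translate (η : Ether) (u v : ℤ) : Ether where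
  val x t := η.val (x + u) (t + v)
  ne_one _ _ := η.ne_one _ _
  periodic_space := by
    obtain ⟨p, hp, h⟩ := η.periodic_space
    exact ⟨p, hp, fun x t => by rw [add_right_comm, h]⟩
  periodic_time := by
    obtain ⟨q, hq, h⟩ := η.periodic_time
    exact ⟨q, hq, fun x t => by rw [add_right_comm, h]⟩

theorem Ether.equivalent_translate (η : Ether) (u v : ℤ) : η.Equivalent (η.translate u v) :=
  ⟨u, v, fun _ _ => rfl⟩

theorem firstLevel_config {L : ℕ} (s : BinarySeed L) :
    firstLevel s.config = fun x => ∑ i, s.vec i * oneOrThreeSingle 0 (x - (i : ℕ)) := by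
  funext x
  simp only [firstLevel, BinarySeed.config, BinarySeed.vec, oneOrThreeSingle, sub_eq_zero]
  by_cases h : ∃ i : Fin (L + 1), ((i : ℕ) : ℤ) = x ∧ s i = true
  · rw [if_pos h]
    obtain ⟨j, rfl, hj⟩ := h
    rw [Finset.sum_eq_single j]
    · simp [hj, CARule.delta]
    · intro i _ hi
      rw [if_neg (show ¬ ((j : ℕ) : ℤ) = (i : ℕ) from
        fun h => hi (Fin.ext (by exact_mod_cast h.symm))), mul_zero]
    · intro h; exact absurd (Finset.mem_univ _) h
  · rw [if_neg h, show CARule.delta 0 = 0 by decide]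
    symm
    refine Finset.sum_eq_zero fun i _ => ?_
    by_cases hx : x = ((i : ℕ) : ℤ)
    · rw [if_neg (fun hi => h ⟨i, hx.symm, hi⟩), zero_mul]
    · rw [if_neg hx, mul_zero]

theorem firstLevel_changeToTwo {ξ : ℤ → Fin 3} {T : Finset ℤ} (hT : ∀ x ∈ T, ξ x = 0) :
    firstLevel (changeToTwo ξ T) = firstLevel ξ := by
  funext x
  simp only [firstLevel, changeToTwo]
  split_ifs with h
  · rw [hT x h]; decide
  · rfl

/-- Above a long void, the first level of the evolution from a seed is a shift of the pattern
row. -/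
theorem webStep_iterate_seed_eq {m t₀ L : ℕ} {a b u : ℤ} (s : BinarySeed L)
    (h : ∀ x, a ≤ x → x ≤ b → oneOrThreeSingle (t₀ - 2 ^ m) x = sparsePattern m (x + u)) (x : ℤ)
    (h1 : a + L ≤ x) (h2 : x ≤ b) :
    webStep^[t₀ - 2 ^ m] (firstLevel s.config) x = patternRow m s.vec (x + u) := by
  rw [firstLevel_config, webStep_sum_mul, patternRow_apply]
  refine Finset.sum_congr rfl fun i _ => ?_
  have e := oneOrThreeSingle_add 0 (t₀ - 2 ^ m)
  rw [zero_add] at e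
  have hi := i.2
  rw [← e, h _ (by omega) (by omega)]
  congr 2; ring

/-- The thickness associated with blocking at level `m`. -/
def blockThickness (m : ℕ) : ℕ := 3 ^ (3 * 2 ^ m) + 8 * 2 ^ m + 3

theorem blockThickness_mono : Monotone blockThickness := by
  intro m n h
  unfold blockThickness
  gcongr <;> norm_num

namespace CARule

variable {f : CARule}

/-- The ether that evolves from a row `c` of period `3 * 2 ^ m` that vanishes after `2 ^ m`
steps. -/
theorem exists_rowEther (hf : f.IsWeb) (m : ℕ) (c : ℤ → ZMod 2) :
    ∃ η : Ether, (∀ x, c (x - 2 ^ m) + c x + c (x + 2 ^ m) = 0) →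
      (f.NoSpontaneousBirth → ∀ x t, η.val x t = 0) ∧
      ∀ k, 3 ^ (3 * 2 ^ m) ≤ k → ∀ x, f.evolve (binaryConfig c) (2 ^ m + k) x = η.val x k := by
  by_cases hc : ∀ x, c (x - 2 ^ m) + c x + c (x + 2 ^ m) = 0
  swap
  · exact ⟨Ether.zero, fun h => absurd h hc⟩
  have hzero : webStep^[2 ^ m] c = 0 := by
    funext x; rw [webStep_iterate_two_pow]; exact hc x
  have hone : ∀ k x, f.evolve (binaryConfig c) (2 ^ m + k) x ≠ 1 := by
    intro k x
    apply ne_one_of_delta_eq_zero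
    change firstLevel (f.evolve (binaryConfig c) (2 ^ m + k)) x = 0
    rw [firstLevel_evolve hf, firstLevel_binaryConfig, add_comm, Function.iterate_add_apply, hzero,
      webStep_iterate_zero]
    rfl
  have hper : ∀ x, binaryConfig c (x + (3 * 2 ^ m : ℕ)) = binaryConfig c x := by
    intro x
    have := periodic_of_sum_eq_zero hc x
    unfold binaryConfig
    push_cast
    rw [this]
  obtain ⟨η, h1, h2⟩ := exists_ether f (ξ := f.evolve (binaryConfig c) (2 ^ m)) (p := 3 * 2 ^ m)
    (by positivity) (evolve_periodic f hper _) (by simpa only [evolve_add] using hone)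
  refine ⟨η, fun _ => ⟨fun hbirth => h1 fun k x => ?_, fun k hk x => ?_⟩⟩
  · have htwo : ∀ n x, f.evolve (binaryConfig c) n x ≠ 2 := by
      intro n
      induction n with
      | zero => exact binaryConfig_ne_two c
      | succ n ih => exact hbirth _ ih
    rw [← evolve_add]
    have e1 := hone k x
    have e2 := htwo (2 ^ m + k) x
    revert e1 e2
    generalize f.evolve (binaryConfig c) (2 ^ m + k) x = y
    revert y; decide
  · rw [evolve_add]; exact h2 k hk x

theorem isReplicator_of_blocked (hf : f.IsWeb) (he : f.EmptyCompliant)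
    {S : (ℤ → ZMod 2) → ℤ → ℤ → Prop} (hT : f.Transmits S) (hS : ShiftInvariant S) {m L : ℕ}
    {s : BinarySeed L} (hblock : Blocked S m s) {η : Ether}
    (hη : ∀ k, 3 ^ (3 * 2 ^ m) ≤ k → ∀ x,
      f.evolve (binaryConfig (patternRow m s.vec)) (2 ^ m + k) x = η.val x k)
    {ξ : ℤ → Fin 3} (hξ : firstLevel ξ = firstLevel s.config) :
    IsReplicator (f.evolve ξ) ((blockThickness m + L : ℕ) : ℝ) η := by
  intro K hK hb
  by_cases hne : ∃ (x : ℤ) (t : ℕ), (x, (t : ℤ)) ∈ K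
  swap
  · refine ⟨η.translate 0 0, η.equivalent_translate 0 0, fun x t hx => ?_⟩
    exact absurd ⟨x, t, hx⟩ hne
  obtain ⟨x₀, t', hx₀⟩ := hne
  have hthick : 3 ≤ blockThickness m := Nat.le_add_left 3 _
  obtain ⟨a, b, c, t₀, ht₀, -, hpat, htri⟩ :=
    exists_void_triangle (r := blockThickness m + L) (by omega) hK hb hx₀
  have hthick' : (blockThickness m : ℤ) = 3 ^ (3 * 2 ^ m) + 8 * 2 ^ m + 3 := by
    rw [blockThickness]; push_cast; ring
  have hp3 : (0 : ℤ) < 3 ^ (3 * 2 ^ m) := by positivity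
  have hp2 : (0 : ℤ) < 2 ^ m := by positivity
  obtain ⟨k₀, -, g1, g2, -⟩ := htri _ hx₀
  push_cast at g1 g2
  -- The void is wider than twice the thickness, which contains the term `8 * 2 ^ m`.
  obtain ⟨hm, u, hu⟩ := exists_sparsePattern m ht₀ (by omega) hpat
  set ζ := f.evolve ξ (t₀ - 2 ^ m) with hζ
  have hlev : ∀ x, a + L ≤ x → x ≤ b → delta (ζ x) = patternRow m s.vec (x + u) := by
    intro x h1 h2
    rw [← webStep_iterate_seed_eq s hu x h1 h2, ← hξ, ← firstLevel_evolve hf]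
    rfl
  have hzero : webStep^[2 ^ m] (patternRow m s.vec) = 0 := by
    funext x; rw [webStep_iterate_two_pow]; exact patternRow_sum m _ x
  refine ⟨η.translate u (-t₀), η.equivalent_translate _ _, fun x t hx => ?_⟩
  obtain ⟨k, hk, h1, h2, h3⟩ := htri _ hx
  simp only at hk h1 h2
  push_cast at h1 h2
  obtain rfl : t = t₀ + k := by omega
  -- Of the thickness, `L` absorbs the width of the seed and `8 * 2 ^ m` the margin `2 * 2 ^ m`; the
  -- term `3 ^ (3 * 2 ^ m)` ensures that `k` is past the transient of the ether.
  have key := evolve_eq_of_not_survives hf he hT hS Nat.one_le_two_pow hblock hzero hlev k x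
    (by push_cast; omega) (by push_cast; omega)
  rw [show t₀ + k = t₀ - 2 ^ m + (2 ^ m + k) by omega, evolve_add, ← hζ, key,
    hη k (by rw [blockThickness] at h3; omega)]
  change η.val (x + u) k = η.val (x + u) (_ + -(t₀ : ℤ))
  congr 1
  push_cast [hm]
  ring

end CARule

open Classical in
/-- The thickness assigned to a seed: that of the first level that is blocked. -/
noncomputable def seedThickness (S : (ℤ → ZMod 2) → ℤ → ℤ → Prop) (L : ℕ) (s : BinarySeed L) :
    ℝ≥0∞ :=
  if h : ∃ m, Blocked S m s then (blockThickness (Nat.find h) : ℝ≥0∞) else ∞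

theorem seedThickness_le {S : (ℤ → ZMod 2) → ℤ → ℤ → Prop} {m L : ℕ} {s : BinarySeed L}
    (h : Blocked S m s) : seedThickness S L s ≤ blockThickness m := by
  classical
  have hex : ∃ m, Blocked S m s := ⟨m, h⟩
  rw [seedThickness, dif_pos hex]
  exact_mod_cast blockThickness_mono (Nat.find_min' hex h)

theorem tendsto_percolation_bound :
    Tendsto (fun n : ℕ => ENNReal.ofReal (24 * ((2 ^ n : ℕ) * (7 / 8 : ℝ) ^ (2 ^ n)))) atTop
      (𝓝 0) := by
  have h1 : Tendsto (fun k : ℕ => (k : ℝ) * (7 / 8 : ℝ) ^ k) atTop (𝓝 0) :=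
    tendsto_self_mul_const_pow_of_lt_one (by norm_num) (by norm_num)
  have h2 := h1.comp (tendsto_pow_atTop_atTop_of_one_lt (show 1 < 2 by norm_num))
  have h3 := ENNReal.tendsto_ofReal (h2.const_mul 24)
  simpa using h3

theorem exists_seedLaw_not_blocked_le {S : (ℤ → ZMod 2) → ℤ → ℤ → Prop} (hS : ShiftInvariant S)
    (hsub : Subcritical S) {ε : ℝ≥0∞} (hε : 0 < ε) :
    ∃ m, ∀ᶠ L in atTop, seedLaw L {s | ¬ Blocked S m s} ≤ ε := by
  obtain ⟨n, hn⟩ := (tendsto_percolation_bound.eventually (ge_mem_nhds hε)).exists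
  refine ⟨n + 3, (eventually_ge_atTop (2 * 2 ^ (n + 3))).mono fun L hL => ?_⟩
  rw [seedLaw_eq_proportion]
  exact (ENNReal.ofReal_le_ofReal (proportion_not_blocked_le hS hsub (by omega))).trans hn

/-- Both kinds of compliance enter only through `Transmits` and `Subcritical`. Allowing any start
with the first level of the seed covers the added `2`s. -/
theorem exists_replicator_of_subcritical (f : CARule) (hf : f.IsWeb) (he : f.EmptyCompliant)
    {S : (ℤ → ZMod 2) → ℤ → ℤ → Prop} (hT : f.Transmits S) (hS : ShiftInvariant S)
    (hsub : Subcritical S) :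
    ∃ (R : ∀ L : ℕ, BinarySeed L → ℝ≥0∞) (η : ∀ L : ℕ, BinarySeed L → Ether),
      Tendsto (fun L => seedLaw L {s | R L s = ∞}) atTop (𝓝 0) ∧
      (∀ ε : ℝ≥0∞, 0 < ε → ∃ K : ℝ≥0, ∀ᶠ L in atTop, seedLaw L {s | (K : ℝ≥0∞) < R L s} ≤ ε) ∧
      (∀ (L : ℕ) (s : BinarySeed L), R L s < ∞ → ∀ ξ, firstLevel ξ = firstLevel s.config →
        IsReplicator (f.evolve ξ) ((R L s).toReal + L) (η L s)) ∧
      (f.NoSpontaneousBirth →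
        ∀ (L : ℕ) (s : BinarySeed L), R L s < ∞ → ∀ x t, (η L s).val x t = 0) ∧
      (∀ η₀ : Ether, (∃ (L₀ : ℕ) (s : BinarySeed L₀), R L₀ s < ∞ ∧ η L₀ s = η₀) →
          0 < liminf (fun L => seedLaw L {s | R L s < ∞ ∧ η L s = η₀}) atTop) := by
  classical
  -- The ether is chosen as a function of the level and the row alone, so that seeds with equal
  -- pattern rows receive the same ether and not merely equivalent ones.
  choose E hE using CARule.exists_rowEther hf
  let η : ∀ L : ℕ, BinarySeed L → Ether := fun L s =>
    if h : ∃ m, Blocked S m s then E (Nat.find h) (patternRow (Nat.find h) s.vec) else Ether.zero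
  have hR : ∀ {L : ℕ} {s : BinarySeed L}, seedThickness S L s < ∞ → ∃ m, Blocked S m s := by
    intro L s h
    by_contra hcon
    rw [seedThickness, dif_neg hcon] at h
    exact lt_irrefl _ h
  refine ⟨seedThickness S, η, ?_, ?_, ?_, ?_, ?_⟩
  · rw [ENNReal.tendsto_nhds_zero]
    intro ε hε
    obtain ⟨m, hm⟩ := exists_seedLaw_not_blocked_le hS hsub hε
    refine hm.mono fun L hL => (measure_mono fun s hs hb => ?_).trans hL
    have h1 := seedThickness_le hb
    rw [show seedThickness S L s = ∞ from hs] at h1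
    exact absurd h1 (by simp)
  · intro ε hε
    obtain ⟨m, hm⟩ := exists_seedLaw_not_blocked_le hS hsub hε
    refine ⟨blockThickness m, hm.mono fun L hL => (measure_mono fun s hs hb => ?_).trans hL⟩
    have h1 := seedThickness_le hb
    have h2 : ((blockThickness m : ℝ≥0) : ℝ≥0∞) < seedThickness S L s := hs
    rw [ENNReal.coe_natCast] at h2
    exact absurd h1 (not_le.mpr h2)
  · intro L s hs ξ hξ
    have hex := hR hs
    have e1 : (seedThickness S L s).toReal + L =
        ((blockThickness (Nat.find hex) + L : ℕ) : ℝ) := by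
      rw [seedThickness, dif_pos hex]
      push_cast
      rw [ENNReal.toReal_natCast]
    have e2 : η L s = E (Nat.find hex) (patternRow (Nat.find hex) s.vec) := dif_pos hex
    rw [e1, e2]
    exact CARule.isReplicator_of_blocked hf he hT hS (Nat.find_spec hex)
      (hE _ _ (patternRow_sum _ _)).2 hξ
  · intro hbirth L s hs
    have hex := hR hs
    have e2 : η L s = E (Nat.find hex) (patternRow (Nat.find hex) s.vec) := dif_pos hex
    rw [e2]
    exact (hE _ _ (patternRow_sum _ _)).1 hbirth
  · rintro η₀ ⟨L₀, s₀, hs₀, rfl⟩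
    have hex := hR hs₀
    obtain ⟨δ, hδ, hle⟩ := exists_le_proportion_patternRow_eq (Nat.find hex) s₀
    refine lt_of_lt_of_le (ENNReal.ofReal_pos.mpr hδ) (le_liminf_of_le (by isBoundedDefault) ?_)
    refine (eventually_ge_atTop L₀).mono fun L hL => ?_
    rw [seedLaw_eq_proportion]
    refine ENNReal.ofReal_le_ofReal ((hle L hL).trans (proportion_mono fun s hs => ?_))
    -- Agreement at all levels up to the first blocked one is needed, so that `s` is not blocked
    -- earlier than `s₀`.
    have hiff : ∀ m ≤ Nat.find hex, (Blocked S m s ↔ Blocked S m s₀) := by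
      intro m hm
      unfold Blocked
      rw [hs m hm]
    have hb := (hiff _ le_rfl).mpr (Nat.find_spec hex)
    have hex' : ∃ m, Blocked S m s := ⟨_, hb⟩
    have hfind : Nat.find hex' = Nat.find hex := by
      refine le_antisymm (Nat.find_min' hex' hb) ?_
      by_contra! hlt
      exact Nat.find_min hex hlt ((hiff _ hlt.le).mp (Nat.find_spec hex'))
    refine ⟨(seedThickness_le hb).trans_lt (ENNReal.natCast_lt_top _), ?_⟩
    have e1 : η L s = E (Nat.find hex') (patternRow (Nat.find hex') s.vec) := dif_pos hex'
    have e2 : η L₀ s₀ = E (Nat.find hex) (patternRow (Nat.find hex) s₀.vec) := dif_pos hex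
    rw [e1, e2, hfind, hs _ le_rfl]

theorem theorem2 (f : CARule) (hweb : f.IsWeb)
    (hcompl : f.DiagonalCompliant ∨ f.WideCompliant) :
    ∃ (R : ∀ L : ℕ, BinarySeed L → ℝ≥0∞) (η : ∀ L : ℕ, BinarySeed L → Ether),
      -- the probability of `R_L = ∞` tends to `0`, and the sequence `R_L` is tight
      Tendsto (fun L => seedLaw L {s | R L s = ∞}) atTop (𝓝 0) ∧
      (∀ ε : ℝ≥0∞, 0 < ε → ∃ K : ℝ≥0, ∀ᶠ L in atTop, seedLaw L {s | (K : ℝ≥0∞) < R L s} ≤ ε) ∧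
      -- if `R_L < ∞`, the seed is a replicator of thickness `R_L + L` and ether `η_L`
      (∀ (L : ℕ) (s : BinarySeed L), R L s < ∞ →
        IsReplicator (f.evolve s.config) ((R L s).toReal + L) (η L s)) ∧
      -- the same holds after changing any finite set of `0`s into `2`s
      (∀ (L : ℕ) (s : BinarySeed L), R L s < ∞ →
        ∀ T : Finset ℤ, (∀ x ∈ T, s.config x = 0) →
          IsReplicator (f.evolve (changeToTwo s.config T)) ((R L s).toReal + L) (η L s)) ∧
      -- (i)
      (f.NoSpontaneousBirth →
        ∀ (L : ℕ) (s : BinarySeed L), R L s < ∞ → ∀ x t, (η L s).val x t = 0) ∧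
      -- (ii)
      (¬ f.NoSpontaneousBirth →
        ∀ η₀ : Ether, (∃ (L₀ : ℕ) (s : BinarySeed L₀), R L₀ s < ∞ ∧ η L₀ s = η₀) →
          0 < liminf (fun L => seedLaw L {s | R L s < ∞ ∧ η L s = η₀}) atTop) := by

  obtain ⟨S, he, hT, hS, hsub⟩ : ∃ S, f.EmptyCompliant ∧ f.Transmits S ∧ ShiftInvariant S ∧
      Subcritical S := by
    rcases hcompl with h | h
    · exact ⟨diagonalStep, h.emptyCompliant, h.transmits, diagonalStep_shiftInvariant,
        diagonalStep_subcritical⟩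
    · exact ⟨wideStep, h.empty, h.transmits, wideStep_shiftInvariant, wideStep_subcritical⟩
  obtain ⟨R, η, h1, h2, h3, h4, h5⟩ := exists_replicator_of_subcritical f hweb he hT hS hsub
  exact ⟨R, η, h1, h2, fun L s hs => h3 L s hs _ rfl,
    fun L s hs T hT => h3 L s hs _ (firstLevel_changeToTwo hT), h4, fun _ => h5⟩
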